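/- **Theorem (discrete Routh reduction).** All manifolds are finite-dimensional, smooth, Hausdorff and second countable. *Setting.* Let $Q$ be a manifold, $L_d:Q\times Q\to\mathbb R$ a smooth function, and $G$ a Lie group acting smoothly, freely and properly on the left on $Q$. Let $\mu\in\mathfrak g^*$ and let $G_\mu=\{g\in G:\operatorname{Ad}^*_{g^{-1}}\mu=\mu\}$ (where $\operatorname{Ad}^*_{g^{-1}}\mu=\mu\circ\operatorname{Ad}_{g^{-1}}$), an embedded Lie subgroup of $G$ with Lie algebra $\mathfrak g_\mu$. Let $\pi_\mu:Q\to Q/G_\mu$ be the quotient map, where $Q/G_\mu$ carries the quotient topology and the manifold structure for which $\pi_\mu$ is a submersion. For $\xi\in\mathfrak g_\mu$ let $\xi_Q$ be its infinitesimal generator on $Q$, and let $\mathcal V_q=\{\xi_Q(q):\xi\in\mathfrak g_\mu\}$. Write $D_1,D_2$ for the partial derivatives with respect to the two arguments. Define $$J_\mu:Q\times Q\to\mathfrak g_\mu^*,\qquad J_\mu(q_0,q_1)\xi=-D_1L_d(q_0,q_1)\,\xi_Q(q_0),$$ and let $\mathcal J_\mu$ be the set of $(q_0,q_1)\in Q\times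 Q$ with $J_\mu(q_0,q_1)=\mu|_{\mathfrak g_\mu}$. Suppose that $G_\mu$ is a *group of $\mu$-good symmetries*, that is: - $L_d(gq_0,gq_1)=L_d(q_0,q_1)$ for all $g\in G_\mu$ and $q_0,q_1\in Q$; - $L_d$ is regular: for all $q_0,q_1\in Q$ the maps $D_2L_d(\cdot,q_1):Q\to T^*_{q_1}Q$ and $-D_1L_d(q_0,\cdot):Q\to T^*_{q_0}Q$ are local diffeomorphisms; - $L_d$ is $G_\mu$-regular: for all $q_0,q_1\in Q$ the restriction of the bilinear form $D_2D_1L_d(q_0,q_1)$ to $\mathcal V_{q_0}\times\mathcal V_{q_1}$ is nondegenerate; - (1) for every $q\in Q$ there is a unique $g\in G_\mu$ with $(q,gq)\in\mathcal J_\mu$; - (2) if $(q_0,q_1)\in\mathcal J_\mu$ and $(q_0,gq_1)\in\mathcal J_\mu$ with $g\in G_\mu$, then $g=e$. *Reduced objects.* Let $\mathfrak U$ be the set of $(q_0,q_1)\in Q\times Q$ for which there is a (necessarily unique) $g\in G_\mu$ with $(q_0,g^{-1}q_1)\in\mathcal J_\mu$; put $\mathcal A_\mu(q_0,q_1):=g$.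 If $(q_0,\tau_1)$ is such that there is a (necessarily unique) $q_1\in\pi_\mu^{-1}(\tau_1)$ with $(q_0,q_1)\in\mathcal J_\mu$, put $\check L_d(q_0,w,\tau_1):=L_d(q_0,wq_1)$ for $w\in G_\mu$. Let $\mathfrak A$ be a principal connection on $\pi_\mu$, and for $q\in Q$ let $h_\mu^q:T_{\pi_\mu(q)}(Q/G_\mu)\to T_qQ$ be its horizontal lift. For $\tau_0=\pi_\mu(q_0)$ and $\tau_1=\pi_\mu(q_1)$ with $(q_0,q_1)\in\mathcal J_\mu$ define $$\breve L_\mu(\tau_0,\tau_1):=\check L_d(q_0,e,\tau_1),$$ $$\breve f_\mu(\tau_0,\tau_1)(\delta\tau_0,\delta\tau_1):=D_2\check L_d(q_0,e,\tau_1)\Big(T_{(q_0,q_1)}\mathcal A_\mu\big(h_\mu^{q_0}(\delta\tau_0),h_\mu^{q_1}(\delta\tau_1)\big)\Big),$$ where $D_2\check L_d$ is the derivative in $w\in G_\mu$; neither depends on the choice of $(q_0,q_1)$. Write $\breve f_\mu(\tau_0,\tau_1)(\delta\tau_0,\delta\tau_1)=\breve f_\mu^-(\tau_0,\tau_1)(\delta\tau_0)+\breve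 f_\mu^+(\tau_0,\tau_1)(\delta\tau_1)$. *Conclusion.* Let $N\ge 0$, let $q_\cdot=(q_0,\dots,q_N)$ be a discrete curve in $Q$ with momentum $\mu$, i.e. $J_\mu(q_k,q_{k+1})=\mu|_{\mathfrak g_\mu}$ for $0\le k<N$, and let $\tau_k:=\pi_\mu(q_k)$. Then the following statements are equivalent. 1. $dS_d(q_\cdot)(\delta q_\cdot)=0$ for every infinitesimal variation $\delta q_\cdot$ (with $\delta q_k\in T_{q_k}Q$) such that $\delta q_0=0$ and $\delta q_N=0$, where $S_d(q_\cdot)=\sum_{k=0}^{N-1}L_d(q_k,q_{k+1})$. 2. $D_2L_d(q_{k-1},q_k)+D_1L_d(q_k,q_{k+1})=0$ for $k=1,\dots,N-1$. 3. $d\breve S_\mu(\tau_\cdot)(\delta\tau_\cdot)=-\sum_{k=0}^{N-1}\breve f_\mu(\tau_k,\tau_{k+1})(\delta\tau_k,\delta\tau_{k+1})$ for every infinitesimal variation $\delta\tau_\cdot$ (with $\delta\tau_k\in T_{\tau_k}(Q/G_\mu)$) such that $\delta\tau_0=0$ and $\delta\tau_N=0$, where $\breve S_\mu(\tau_\cdot)=\sum_{k=0}^{N-1}\breve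 L_\mu(\tau_k,\tau_{k+1})$. 4. $D_1\breve L_\mu(\tau_k,\tau_{k+1})+D_2\breve L_\mu(\tau_{k-1},\tau_k)+\breve f_\mu^+(\tau_{k-1},\tau_k)+\breve f_\mu^-(\tau_k,\tau_{k+1})=0$ for $k=1,\dots,N-1$. -/

import Mathlib

open scoped Manifold ContDiff

namespace DiscreteRouth

noncomputable section

/-! ### Discrete mechanics on a manifold -/

section Mechanics

variable {E : Type*} [NormedAddCommGroup E] [NormedSpace ℝ E]
  {M : Type*} [TopologicalSpace M] [ChartedSpace E M]

/-- `D₁ L (x, y) ∈ T*ₓM`, the first partial derivative of `L : M × M → ℝ`. -/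
def D₁ (E : Type*) [NormedAddCommGroup E] [NormedSpace ℝ E]
    {M : Type*} [TopologicalSpace M] [ChartedSpace E M]
    (L : M × M → ℝ) (x y : M) : TangentSpace 𝓘(ℝ, E) x →L[ℝ] ℝ :=
  mfderiv 𝓘(ℝ, E) 𝓘(ℝ, ℝ) (fun x' => L (x', y)) x

/-- `D₂ L (x, y) ∈ T*_yM`, the second partial derivative of `L : M × M → ℝ`. -/
def D₂ (E : Type*) [NormedAddCommGroup E] [NormedSpace ℝ E]
    {M : Type*} [TopologicalSpace M] [ChartedSpace E M]
    (L : M × M → ℝ) (x y : M) : TangentSpace 𝓘(ℝ, E) y →L[ℝ] ℝ :=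
  mfderiv 𝓘(ℝ, E) 𝓘(ℝ, ℝ) (fun y' => L (x, y')) y

/-- The bilinear form `D₂D₁ L (x, y) : TₓM × T_yM → ℝ`: the derivative at `y`, in the direction `v`,
of `y' ↦ D₁ L (x, y') u`. -/
def D₂D₁ (L : M × M → ℝ) (x y : M)
    (u : TangentSpace 𝓘(ℝ, E) x) (v : TangentSpace 𝓘(ℝ, E) y) : ℝ :=
  mfderiv 𝓘(ℝ, E) 𝓘(ℝ, ℝ) (fun y' => D₁ E L x y' u) y v

/-- The discrete action `S(q.) = ∑_{k < N} L(q_k, q_{k+1})` of discrete curves `(q_0, …, q_N)`. -/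
def action (N : ℕ) (L : M × M → ℝ) (q : Fin (N + 1) → M) : ℝ :=
  ∑ k : Fin N, L (q k.castSucc, q k.succ)

/-- An infinitesimal variation of the discrete curve `q.`. -/
abbrev Variation (E : Type*) [NormedAddCommGroup E] [NormedSpace ℝ E]
    {M : Type*} [TopologicalSpace M] [ChartedSpace E M] {N : ℕ} (q : Fin (N + 1) → M) : Type _ :=
  ∀ k, TangentSpace 𝓘(ℝ, E) (q k)

/-- The variation vanishes at both endpoints. -/
def FixedEndpoints {N : ℕ} {q : Fin (N + 1) → M} (δq : Variation E q) : Prop :=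
  δq 0 = 0 ∧ δq (Fin.last N) = 0

/-- `dS(q.)(δq.)`: the differential of the action, a function on the manifold `M^{N+1}`. -/
def dAction {N : ℕ} (L : M × M → ℝ) (q : Fin (N + 1) → M) (δq : Variation E q) : ℝ :=
  mfderiv (ModelWithCorners.pi fun _ : Fin (N + 1) => 𝓘(ℝ, E)) 𝓘(ℝ, ℝ) (action N L) q δq

/-- The discrete Hamilton principle: `q.` is a trajectory of the system `(M, L)`. -/
def IsTrajectory (E : Type*) [NormedAddCommGroup E] [NormedSpace ℝ E]
    {M : Type*} [TopologicalSpace M] [ChartedSpace E M]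
    {N : ℕ} (L : M × M → ℝ) (q : Fin (N + 1) → M) : Prop :=
  ∀ δq : Variation E q, FixedEndpoints δq → dAction L q δq = 0

/-- The discrete Euler–Lagrange equations, at the interior points `q_{k+1}`, `k + 2 ≤ N`. -/
def DiscreteEulerLagrange (E : Type*) [NormedAddCommGroup E] [NormedSpace ℝ E]
    {M : Type*} [TopologicalSpace M] [ChartedSpace E M]
    {N : ℕ} (L : M × M → ℝ) (q : Fin (N + 1) → M) : Prop :=
  ∀ (k : ℕ) (h₂ : k + 2 < N + 1) (h₁ : k + 1 < N + 1) (h₀ : k < N + 1),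
    D₂ E L (q ⟨k, h₀⟩) (q ⟨k + 1, h₁⟩) + D₁ E L (q ⟨k + 1, h₁⟩) (q ⟨k + 2, h₂⟩) = 0

/-- A discrete force: a `1`-form on `M × M`, given pointwise on `TₓM × T_yM`. -/
abbrev Force (E : Type*) [NormedAddCommGroup E] [NormedSpace ℝ E]
    (M : Type*) [TopologicalSpace M] [ChartedSpace E M] : Type _ :=
  ∀ x y : M, (TangentSpace 𝓘(ℝ, E) x × TangentSpace 𝓘(ℝ, E) y) →L[ℝ] ℝ

/-- The component `f⁻(x, y) ∈ T*ₓM` of a force. -/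
def Force.minus (f : Force E M) (x y : M) : TangentSpace 𝓘(ℝ, E) x →L[ℝ] ℝ :=
  (f x y).comp (ContinuousLinearMap.inl ℝ (TangentSpace 𝓘(ℝ, E) x) (TangentSpace 𝓘(ℝ, E) y))

/-- The component `f⁺(x, y) ∈ T*_yM` of a force. -/
def Force.plus (f : Force E M) (x y : M) : TangentSpace 𝓘(ℝ, E) y →L[ℝ] ℝ :=
  (f x y).comp (ContinuousLinearMap.inr ℝ (TangentSpace 𝓘(ℝ, E) x) (TangentSpace 𝓘(ℝ, E) y))

/-- The forced variational principle
`dS(q.)(δq.) = - ∑_{k < N} f(q_k, q_{k+1})(δq_k, δq_{k+1})`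
for all variations with fixed endpoints. -/
def IsForcedTrajectory {N : ℕ} (L : M × M → ℝ) (f : Force E M) (q : Fin (N + 1) → M) : Prop :=
  ∀ δq : Variation E q, FixedEndpoints δq →
    dAction L q δq =
      - ∑ k : Fin N, f (q k.castSucc) (q k.succ) (δq k.castSucc, δq k.succ)

/-- The forced discrete Euler–Lagrange equations, at the interior points. -/
def ForcedDiscreteEulerLagrange {N : ℕ} (L : M × M → ℝ) (f : Force E M)
    (q : Fin (N + 1) → M) : Prop :=
  ∀ (k : ℕ) (h₂ : k + 2 < N + 1) (h₁ : k + 1 < N + 1) (h₀ : k < N + 1),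
    D₁ E L (q ⟨k + 1, h₁⟩) (q ⟨k + 2, h₂⟩) + D₂ E L (q ⟨k, h₀⟩) (q ⟨k + 1, h₁⟩)
      + f.plus (q ⟨k, h₀⟩) (q ⟨k + 1, h₁⟩) + f.minus (q ⟨k + 1, h₁⟩) (q ⟨k + 2, h₂⟩) = 0

/-- Regularity of the discrete Lagrangian: `q₀ ↦ D₂L(q₀, q₁) ∈ T*_{q₁}M` and
`q₁ ↦ -D₁L(q₀, q₁) ∈ T*_{q₀}M` are local diffeomorphisms. -/
def IsRegular (E : Type*) [NormedAddCommGroup E] [NormedSpace ℝ E]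
    {M : Type*} [TopologicalSpace M] [ChartedSpace E M] (L : M × M → ℝ) : Prop :=
  (∀ q₁ : M, IsLocalDiffeomorph (N := E →L[ℝ] ℝ) 𝓘(ℝ, E) 𝓘(ℝ, E →L[ℝ] ℝ) ∞
      (fun q₀ : M => D₂ E L q₀ q₁)) ∧
  (∀ q₀ : M, IsLocalDiffeomorph (N := E →L[ℝ] ℝ) 𝓘(ℝ, E) 𝓘(ℝ, E →L[ℝ] ℝ) ∞
      (fun q₁ : M => -D₁ E L q₀ q₁))

end Mechanics

/-! ### The adjoint action and coadjoint isotropy groups -/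

section Adjoint

variable {E : Type*} [NormedAddCommGroup E] [NormedSpace ℝ E]
  {G : Type*} [TopologicalSpace G] [ChartedSpace E G] [Group G]

/-- The adjoint action `Ad_g : 𝔤 → 𝔤`, the derivative at `e` of `h ↦ g h g⁻¹`. -/
def Ad (g : G) : GroupLieAlgebra 𝓘(ℝ, E) G →L[ℝ] GroupLieAlgebra 𝓘(ℝ, E) G :=
  mfderiv 𝓘(ℝ, E) 𝓘(ℝ, E) (fun h : G => g * h * g⁻¹) 1

theorem Ad_one : Ad (E := E) (1 : G) = ContinuousLinearMap.id ℝ _ := by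
  have : (fun h : G => (1 : G) * h * (1 : G)⁻¹) = id := by ext; simp
  unfold Ad
  rw [this]
  exact mfderiv_id

variable [LieGroup 𝓘(ℝ, E) ∞ G]

theorem mdifferentiableAt_conj (g x : G) :
    MDifferentiableAt 𝓘(ℝ, E) 𝓘(ℝ, E) (fun h : G => g * h * g⁻¹) x := by
  have h : ContMDiff 𝓘(ℝ, E) 𝓘(ℝ, E) ∞ (fun h : G => g * h * g⁻¹) :=
    (contMDiff_const.mul contMDiff_id).mul contMDiff_const
  exact h.mdifferentiableAt (by simp)

theorem Ad_mul (a b : G) : Ad (E := E) (a * b) = (Ad a).comp (Ad b) := by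
  have h1 : (fun h : G => (a * b) * h * (a * b)⁻¹)
      = (fun h : G => a * h * a⁻¹) ∘ (fun h : G => b * h * b⁻¹) := by
    ext; simp [mul_assoc]
  have h2 := mfderiv_comp (I := 𝓘(ℝ, E)) (I' := 𝓘(ℝ, E)) (I'' := 𝓘(ℝ, E)) (1 : G)
    (mdifferentiableAt_conj (E := E) a (b * 1 * b⁻¹)) (mdifferentiableAt_conj (E := E) b 1)
  unfold Ad
  rw [h1]
  refine h2.trans ?_
  have h3 : b * 1 * b⁻¹ = 1 := by simp
  ext v
  show mfderiv 𝓘(ℝ, E) 𝓘(ℝ, E) (fun h : G => a * h * a⁻¹) (b * 1 * b⁻¹) _ = _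
  rw [h3]
  rfl

/-- The isotropy group `G_μ = {g ∈ G | Ad*_{g⁻¹} μ = μ}` of `μ ∈ 𝔤*`, where
`Ad*_{g⁻¹} μ = μ ∘ Ad_{g⁻¹}`. -/
def coadjointIsotropy (μ : GroupLieAlgebra 𝓘(ℝ, E) G →L[ℝ] ℝ) : Subgroup G where
  carrier := {g | μ.comp (Ad g⁻¹) = μ}
  one_mem' := by
    simp only [Set.mem_ofPred_eq, inv_one, Ad_one]
    exact μ.comp_id
  mul_mem' := by
    intro a b ha hb
    simp only [Set.mem_ofPred_eq] at ha hb ⊢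
    rw [mul_inv_rev, Ad_mul, ← ContinuousLinearMap.comp_assoc, hb, ha]
  inv_mem' := by
    intro a ha
    simp only [Set.mem_ofPred_eq] at ha ⊢
    have h : (μ.comp (Ad a⁻¹)).comp (Ad a⁻¹⁻¹) = μ := by
      rw [ContinuousLinearMap.comp_assoc, ← Ad_mul, mul_inv_cancel, Ad_one]
      exact μ.comp_id
    rwa [ha] at h

/-- The restriction of `μ ∈ 𝔤*` to `𝔤_μ = Lie(G_μ)`, along the derivative at `e` of the inclusion
`G_μ → G`. -/
def restrictToIsotropy (F : Type*) [NormedAddCommGroup F] [NormedSpace ℝ F]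
    (μ : GroupLieAlgebra 𝓘(ℝ, E) G →L[ℝ] ℝ) [ChartedSpace F (coadjointIsotropy μ)] :
    GroupLieAlgebra 𝓘(ℝ, F) (coadjointIsotropy μ) →L[ℝ] ℝ :=
  μ.comp (mfderiv 𝓘(ℝ, F) 𝓘(ℝ, E) (Subtype.val : coadjointIsotropy μ → G) 1)

end Adjoint

/-! ### Symmetries, momentum maps and principal connections

`K` is a Lie group (modelled on `F`) acting on the manifold `Q` (modelled on `E`). -/

section Symmetry

variable {E : Type*} [NormedAddCommGroup E] [NormedSpace ℝ E]
  {F : Type*} [NormedAddCommGroup F] [NormedSpace ℝ F]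
  {B : Type*} [NormedAddCommGroup B] [NormedSpace ℝ B]
  {Q : Type*} [TopologicalSpace Q] [ChartedSpace E Q]
  {K : Type*} [TopologicalSpace K] [ChartedSpace F K] [Group K] [MulAction K Q]

/-- The infinitesimal generator `ξ_Q(q) = d/dt|₀ exp(tξ) • q`, that is, the derivative at `e` of
the orbit map `g ↦ g • q` applied to `ξ`. -/
def infGen (E F : Type*) [NormedAddCommGroup E] [NormedSpace ℝ E]
    [NormedAddCommGroup F] [NormedSpace ℝ F]
    {Q : Type*} [TopologicalSpace Q] [ChartedSpace E Q]
    (K : Type*) [TopologicalSpace K] [ChartedSpace F K] [Group K] [MulAction K Q] (q : Q) :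
    GroupLieAlgebra 𝓘(ℝ, F) K →L[ℝ] TangentSpace 𝓘(ℝ, E) q :=
  mfderiv 𝓘(ℝ, F) 𝓘(ℝ, E) (fun g : K => g • q) 1

/-- The discrete momentum map `J(q₀, q₁) ξ = -D₁L(q₀, q₁) ξ_Q(q₀)`. -/
def momentumMap (E F : Type*) [NormedAddCommGroup E] [NormedSpace ℝ E]
    [NormedAddCommGroup F] [NormedSpace ℝ F]
    {Q : Type*} [TopologicalSpace Q] [ChartedSpace E Q]
    (K : Type*) [TopologicalSpace K] [ChartedSpace F K] [Group K] [MulAction K Q]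
    (L : Q × Q → ℝ) (q₀ q₁ : Q) : GroupLieAlgebra 𝓘(ℝ, F) K →L[ℝ] ℝ :=
  -(D₁ E L q₀ q₁).comp (infGen E F K q₀)

/-- The level set `𝒥 = J⁻¹(ν)`. -/
def momentumLevel (E : Type*) [NormedAddCommGroup E] [NormedSpace ℝ E]
    {Q : Type*} [TopologicalSpace Q] [ChartedSpace E Q] [MulAction K Q]
    (L : Q × Q → ℝ) (ν : GroupLieAlgebra 𝓘(ℝ, F) K →L[ℝ] ℝ) : Set (Q × Q) :=
  {p | momentumMap E F K L p.1 p.2 = ν}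

/-- `L` is `K`-regular: for all `(q₀, q₁)` the restriction of `D₂D₁L(q₀, q₁)` to
`𝒱_{q₀} × 𝒱_{q₁}` is nondegenerate, where the vertical space `𝒱_q` (the tangent space at `q` of the
orbit of `q`) consists of the vectors `ξ_Q(q)`. -/
def IsGroupRegular (E F : Type*) [NormedAddCommGroup E] [NormedSpace ℝ E]
    [NormedAddCommGroup F] [NormedSpace ℝ F]
    {Q : Type*} [TopologicalSpace Q] [ChartedSpace E Q]
    (K : Type*) [TopologicalSpace K] [ChartedSpace F K] [Group K] [MulAction K Q]
    (L : Q × Q → ℝ) : Prop :=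
  ∀ q₀ q₁ : Q,
    (∀ u ∈ Set.range (infGen E F K q₀),
      (∀ v ∈ Set.range (infGen E F K q₁), D₂D₁ L q₀ q₁ u v = 0) → u = 0) ∧
    (∀ v ∈ Set.range (infGen E F K q₁),
      (∀ u ∈ Set.range (infGen E F K q₀), D₂D₁ L q₀ q₁ u v = 0) → v = 0)

/-- `K` is a group of `ν`-good symmetries of the discrete mechanical system `(Q, L)`. -/
structure IsGoodSymmetry (E : Type*) [NormedAddCommGroup E] [NormedSpace ℝ E]
    {Q : Type*} [TopologicalSpace Q] [ChartedSpace E Q] [MulAction K Q]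
    (L : Q × Q → ℝ) (ν : GroupLieAlgebra 𝓘(ℝ, F) K →L[ℝ] ℝ) : Prop where
  invariant : ∀ (g : K) (q₀ q₁ : Q), L (g • q₀, g • q₁) = L (q₀, q₁)
  regular : IsRegular E L
  groupRegular : IsGroupRegular E F K L
  existsUnique_level : ∀ q : Q, ∃! g : K, momentumMap E F K L q (g • q) = ν
  eq_one : ∀ (q₀ q₁ : Q) (g : K), momentumMap E F K L q₀ q₁ = ν →
    momentumMap E F K L q₀ (g • q₁) = ν → g = 1

/-- The quotient map `π : Q → Q/K`. -/
def proj (K : Type*) {Q : Type*} [Group K] [MulAction K Q] (q : Q) :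
    MulAction.orbitRel.Quotient K Q :=
  Quotient.mk'' q

/-- A principal connection on `Q → Q/K`, given by its connection form `𝔄 : TQ → 𝔨`: smooth,
linear on each tangent space, with `𝔄(ξ_Q(q)) = ξ` and `𝔄(g • v) = Ad_g 𝔄(v)`. -/
structure PrincipalConnection (E F : Type*) [NormedAddCommGroup E] [NormedSpace ℝ E]
    [NormedAddCommGroup F] [NormedSpace ℝ F]
    (K : Type*) [TopologicalSpace K] [ChartedSpace F K] [Group K]
    (Q : Type*) [TopologicalSpace Q] [ChartedSpace E Q] [IsManifold 𝓘(ℝ, E) 1 Q]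
    [MulAction K Q] where
  form : ∀ q : Q, TangentSpace 𝓘(ℝ, E) q →L[ℝ] GroupLieAlgebra 𝓘(ℝ, F) K
  smooth : ContMDiff (M' := F) 𝓘(ℝ, E).tangent 𝓘(ℝ, F) ∞
    (fun v : TangentBundle 𝓘(ℝ, E) Q => form v.1 v.2)
  form_infGen : ∀ (q : Q) (ξ : GroupLieAlgebra 𝓘(ℝ, F) K), form q (infGen E F K q ξ) = ξ
  form_smul : ∀ (g : K) (q : Q) (v : TangentSpace 𝓘(ℝ, E) q),
    form (g • q) (mfderiv 𝓘(ℝ, E) 𝓘(ℝ, E) (fun x : Q => g • x) q v) = Ad g (form q v)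

/-- The horizontal lift `h^q : T_{π(q)}(Q/K) → T_qQ`: `h^q(w)` is the vector `v` with
`T_qπ(v) = w` and `𝔄(v) = 0`, that is, the preimage of `(w, 0)` under the isomorphism
`v ↦ (T_qπ(v), 𝔄(v))` from `T_qQ` to `T_{π(q)}(Q/K) × 𝔨`. -/
def horizontalLift [IsManifold 𝓘(ℝ, E) 1 Q]
    [ChartedSpace B (MulAction.orbitRel.Quotient K Q)]
    (𝔄 : PrincipalConnection E F K Q) (q : Q) :
    TangentSpace 𝓘(ℝ, B) (proj K q) →L[ℝ] TangentSpace 𝓘(ℝ, E) q :=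
  (((mfderiv 𝓘(ℝ, E) 𝓘(ℝ, B) (proj K) q).prod (𝔄.form q)).inverse).comp
    (ContinuousLinearMap.inl ℝ (TangentSpace 𝓘(ℝ, B) (proj K q)) (GroupLieAlgebra 𝓘(ℝ, F) K))

/-! ### The affine discrete connection of the momentum map and the reduced system -/

/-- The affine discrete connection `𝒜(q₀, q₁) ∈ K` associated to the momentum map: the element `g`
with `(q₀, g⁻¹ • q₁) ∈ 𝒥`, for the pairs for which there is one (arbitrary elsewhere). -/
def affineConnection (E : Type*) [NormedAddCommGroup E] [NormedSpace ℝ E]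
    {Q : Type*} [TopologicalSpace Q] [ChartedSpace E Q] [MulAction K Q]
    (L : Q × Q → ℝ) (ν : GroupLieAlgebra 𝓘(ℝ, F) K →L[ℝ] ℝ) (p : Q × Q) : K :=
  Classical.epsilon fun g : K => (p.1, g⁻¹ • p.2) ∈ momentumLevel E L ν

/-- The discrete horizontal lift of `τ₁ ∈ Q/K` at `q₀`: the point `q₁` with `(q₀, q₁) ∈ 𝒥` and
`π(q₁) = τ₁`, where there is one (arbitrary elsewhere). -/
def discreteLift (E : Type*) [NormedAddCommGroup E] [NormedSpace ℝ E]
    {Q : Type*} [TopologicalSpace Q] [ChartedSpace E Q] [MulAction K Q]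
    (L : Q × Q → ℝ) (ν : GroupLieAlgebra 𝓘(ℝ, F) K →L[ℝ] ℝ)
    (q₀ : Q) (τ₁ : MulAction.orbitRel.Quotient K Q) : Q :=
  @Classical.epsilon Q ⟨q₀⟩ fun q₁ => (q₀, q₁) ∈ momentumLevel E L ν ∧ proj K q₁ = τ₁

/-- The Lagrangian `Ľ(q₀, w, τ₁) = L(q₀, w • q₁)` on `Q × K × Q/K`, with `q₁` the discrete
horizontal lift of `τ₁` at `q₀`. -/
def checkLagrangian (E : Type*) [NormedAddCommGroup E] [NormedSpace ℝ E]
    {Q : Type*} [TopologicalSpace Q] [ChartedSpace E Q] [MulAction K Q]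
    (L : Q × Q → ℝ) (ν : GroupLieAlgebra 𝓘(ℝ, F) K →L[ℝ] ℝ)
    (q₀ : Q) (w : K) (τ₁ : MulAction.orbitRel.Quotient K Q) : ℝ :=
  L (q₀, w • discreteLift E L ν q₀ τ₁)

/-- The reduced Lagrangian `L̆(τ₀, τ₁) = Ľ(q₀, e, τ₁)` on `Q/K × Q/K`, for any `q₀` over `τ₀` (by
invariance, the value does not depend on `q₀`). -/
def reducedLagrangian (E : Type*) [NormedAddCommGroup E] [NormedSpace ℝ E]
    {Q : Type*} [TopologicalSpace Q] [ChartedSpace E Q] [MulAction K Q]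
    (L : Q × Q → ℝ) (ν : GroupLieAlgebra 𝓘(ℝ, F) K →L[ℝ] ℝ)
    (τ : MulAction.orbitRel.Quotient K Q × MulAction.orbitRel.Quotient K Q) : ℝ :=
  checkLagrangian E L ν (Quotient.out τ.1) 1 τ.2

/-- For `q₀` over `τ₀` and `(q₀, q₁) ∈ 𝒥` with `q₁` over `τ₁`, the linear form
`(δτ₀, δτ₁) ↦ D₂Ľ(q₀, e, τ₁) (T_{(q₀, q₁)}𝒜 (h^{q₀}(δτ₀), h^{q₁}(δτ₁)))`. -/
def reducedForceAt [IsManifold 𝓘(ℝ, E) 1 Q]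
    [ChartedSpace B (MulAction.orbitRel.Quotient K Q)]
    (L : Q × Q → ℝ) (ν : GroupLieAlgebra 𝓘(ℝ, F) K →L[ℝ] ℝ)
    (𝔄 : PrincipalConnection E F K Q) (q₀ q₁ : Q) :
    (TangentSpace 𝓘(ℝ, B) (proj K q₀) × TangentSpace 𝓘(ℝ, B) (proj K q₁)) →L[ℝ] ℝ :=
  let D₂Ľ : GroupLieAlgebra 𝓘(ℝ, F) K →L[ℝ] ℝ :=
    mfderiv 𝓘(ℝ, F) 𝓘(ℝ, ℝ) (fun w : K => checkLagrangian E L ν q₀ w (proj K q₁)) 1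
  let T𝒜 : (TangentSpace 𝓘(ℝ, E) q₀ × TangentSpace 𝓘(ℝ, E) q₁) →L[ℝ] GroupLieAlgebra 𝓘(ℝ, F) K :=
    mfderiv (𝓘(ℝ, E).prod 𝓘(ℝ, E)) 𝓘(ℝ, F) (affineConnection E L ν) (q₀, q₁)
  (D₂Ľ.comp T𝒜).comp ((horizontalLift 𝔄 q₀).prodMap (horizontalLift 𝔄 q₁))

/-- The reduced force `f̆` on `Q/K × Q/K`: `f̆(τ₀, τ₁)` is `reducedForceAt` at any `q₀` over `τ₀`,
with `q₁` the discrete horizontal lift of `τ₁` at `q₀` (by equivariance, it does not depend on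
`q₀`). -/
def reducedForce [IsManifold 𝓘(ℝ, E) 1 Q]
    [ChartedSpace B (MulAction.orbitRel.Quotient K Q)]
    (L : Q × Q → ℝ) (ν : GroupLieAlgebra 𝓘(ℝ, F) K →L[ℝ] ℝ)
    (𝔄 : PrincipalConnection E F K Q) : Force B (MulAction.orbitRel.Quotient K Q) :=
  fun τ₀ τ₁ => reducedForceAt L ν 𝔄 (Quotient.out τ₀) (discreteLift E L ν (Quotient.out τ₀) τ₁)

end Symmetry

end

end DiscreteRouth

/-!
Write `K = G_μ`, let `𝒥` be the level set of the momentum map, `𝒜` the affine discrete connection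
and `π : Q → Q/K` the projection. The two variational principles are equivalent to their pointwise
equations by varying one interior point at a time (`isTrajectory_iff`, `isForcedTrajectory_iff`), so
the content is the equivalence, at each interior point `y` of a curve `x, y, z` with momentum `μ`,
of the discrete Euler–Lagrange equation `φ = D₂L(x, y) + D₁L(y, z) = 0` with the reduced forced
equation (`IsRouthSystem.eulerLagrange_iff_reduced`).

A principal connection splits `T_yQ` into vertical and horizontal vectors. On vertical vectors `φ`
vanishes automatically: by invariance of `L`, its value on `ξ_Q(y)` is `J(x, y) ξ - J(y, z) ξ`. On
horizontal vectors `φ` is the left-hand side of the reduced equation. Indeed, near `𝒥` invariance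
gives `L̆(π(x), π(y)) = L(𝒜(x, y) • x, y)`, with `𝒜 = e` on `𝒥`. Differentiating this along
horizontal lifts yields `dL̆ + f̆ = dL ∘ (h × h)`: the derivative of `𝒜` contributes exactly `-f̆`
(`IsRouthSystem.dReduced_add_reducedForceAt`). The right-hand side is invariant under `K`, so
the identity also holds for the representatives chosen in the definition of `f̆`
(`IsRouthSystem.dReduced_add_reducedForce`).

Two facts of differential topology enter. `𝒜` is differentiable at the points of `𝒥`, by the
implicit function theorem: the linearization of the equation `(x, g • y) ∈ 𝒥` in `g` is the form
`D₂D₁L` on vertical vectors, which is nondegenerate (`IsGoodSymmetry.affineConnection_spec`). And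
the kernel of `Tπ` is the vertical space (`IsRouthSystem.exists_infGen_eq`), so that the horizontal
lift is the inverse of a genuine isomorphism. The latter needs neither a slice theorem nor a
dimension count: if `(x, y) ∈ 𝒥` and `s` is the discrete horizontal lift at `x`, then the points
near `y` satisfy `z = 𝒜(x, z) • s(π(z))`, and differentiating in a direction killed by `Tπ` leaves
an infinitesimal generator.

The fibres of the tangent bundle are definitionally the model space. Where several tangent spaces
meet in one formula, derivatives are written as continuous linear maps between model spaces,
introduced by an equation.
-/

open scoped Manifold ContDiff

namespace DiscreteRouth

open Filter Topology

/-! ### The chain rule for functions of two arguments -/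

section Chain

variable {E₁ : Type*} [NormedAddCommGroup E₁] [NormedSpace ℝ E₁] {H₁ : Type*} [TopologicalSpace H₁]
  {I₁ : ModelWithCorners ℝ E₁ H₁} {M₁ : Type*} [TopologicalSpace M₁] [ChartedSpace H₁ M₁]
  {E₂ : Type*} [NormedAddCommGroup E₂] [NormedSpace ℝ E₂] {H₂ : Type*} [TopologicalSpace H₂]
  {I₂ : ModelWithCorners ℝ E₂ H₂} {M₂ : Type*} [TopologicalSpace M₂] [ChartedSpace H₂ M₂]
  {E₃ : Type*} [NormedAddCommGroup E₃] [NormedSpace ℝ E₃] {H₃ : Type*} [TopologicalSpace H₃]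
  {I₃ : ModelWithCorners ℝ E₃ H₃} {M₃ : Type*} [TopologicalSpace M₃] [ChartedSpace H₃ M₃]
  {E₄ : Type*} [NormedAddCommGroup E₄] [NormedSpace ℝ E₄] {H₄ : Type*} [TopologicalSpace H₄]
  {I₄ : ModelWithCorners ℝ E₄ H₄} {P : Type*} [TopologicalSpace P] [ChartedSpace H₄ P]

theorem mfderiv_comp₂_apply {f : M₁ × M₂ → M₃} {a : P → M₁} {b : P → M₂} {p : P} {x : M₁} {y : M₂}
    (hf : MDifferentiableAt (I₁.prod I₂) I₃ f (x, y))
    (ha : MDifferentiableAt I₄ I₁ a p) (hb : MDifferentiableAt I₄ I₂ b p)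
    (hx : a p = x) (hy : b p = y) (v : E₄) :
    (mfderiv I₄ I₃ (fun p => f (a p, b p)) p : E₄ →L[ℝ] E₃) v =
      (mfderiv I₁ I₃ (fun x' => f (x', y)) x : E₁ →L[ℝ] E₃) ((mfderiv I₄ I₁ a p : E₄ →L[ℝ] E₁) v) +
      (mfderiv I₂ I₃ (fun y' => f (x, y')) y : E₂ →L[ℝ] E₃)
        ((mfderiv I₄ I₂ b p : E₄ →L[ℝ] E₂) v) := by
  subst hx hy
  have h1 := mfderiv_comp_apply (I := I₄) (I' := I₁.prod I₂) (I'' := I₃) p hf (ha.prodMk hb) v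
  refine h1.trans ?_
  rw [mfderiv_prod_eq_add_apply hf, mfderiv_prodMk ha hb]
  rfl

end Chain

/-! ### First variation of a discrete action -/

section Variation

/-- A discrete integration by parts: the endpoints of the curve being fixed, the sum vanishes for
all variations exactly when the coefficient of each interior point does. -/
theorem sum_eq_zero_iff_interior {E : Type*} [AddCommGroup E] [Module ℝ E] [TopologicalSpace E]
    {N : ℕ} (a b : Fin N → (E →L[ℝ] ℝ)) :
    (∀ δ : Fin (N + 1) → E, δ 0 = 0 → δ (Fin.last N) = 0 →
      ∑ k : Fin N, (a k (δ k.castSucc) + b k (δ k.succ)) = 0) ↔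
    ∀ (k : ℕ) (h : k + 1 < N), b ⟨k, by omega⟩ + a ⟨k + 1, h⟩ = 0 := by
  rcases N with _ | m
  · simp
  have key : ∀ δ : Fin (m + 2) → E, δ 0 = 0 → δ (Fin.last (m + 1)) = 0 →
      ∑ k : Fin (m + 1), (a k (δ k.castSucc) + b k (δ k.succ)) =
        ∑ k : Fin m, (b k.castSucc + a k.succ) (δ k.succ.castSucc) := by
    intro δ h0 hl
    rw [Finset.sum_add_distrib, Fin.sum_univ_succ, Fin.sum_univ_castSucc (fun k => b k (δ k.succ))]
    have e0 : δ (Fin.castSucc 0) = 0 := h0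
    have el : δ (Fin.last m).succ = 0 := hl
    rw [e0, el, map_zero, map_zero, zero_add, add_zero, ← Finset.sum_add_distrib]
    refine Finset.sum_congr rfl fun k _ => ?_
    rw [Fin.succ_castSucc, add_comm]
    rfl
  constructor
  · intro H k hk
    ext v
    set j : Fin m := ⟨k, by omega⟩
    -- the variation equal to `v` at the point `k + 1` of the curve, and to zero elsewhere
    have hne0 : (0 : Fin (m + 2)) ≠ j.succ.castSucc := by
      intro h; simpa using congrArg Fin.val h
    have hnel : Fin.last (m + 1) ≠ j.succ.castSucc := by
      intro h
      have h1 := congrArg Fin.val h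
      have h2 := j.2
      simp only [Fin.val_last, Fin.val_castSucc, Fin.val_succ] at h1
      omega
    have h := H (Pi.single j.succ.castSucc v) (Pi.single_eq_of_ne hne0 _)
      (Pi.single_eq_of_ne hnel _)
    rw [key _ (Pi.single_eq_of_ne hne0 _) (Pi.single_eq_of_ne hnel _),
      Finset.sum_eq_single j] at h
    · simpa only [Pi.single_eq_same] using! h
    · intro i _ hi
      rw [Pi.single_eq_of_ne, map_zero]
      exact fun hh => hi (Fin.succ_injective _ (Fin.castSucc_injective _ hh))
    · simp
  · intro H δ h0 hl
    rw [key δ h0 hl]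
    refine Finset.sum_eq_zero fun k _ => ?_
    have := H k (by have := k.2; omega)
    have h1 : b k.castSucc + a k.succ = 0 := this
    rw [h1]; rfl

variable {E : Type*} [NormedAddCommGroup E] [NormedSpace ℝ E]
  {M : Type*} [TopologicalSpace M] [ChartedSpace E M]

/-- In the product charts, evaluation at `k` is the projection to the `k`-th factor. -/
theorem hasMFDerivAt_eval {ι : Type*} [Fintype ι] (q : ι → M) (k : ι) :
    HasMFDerivAt (ModelWithCorners.pi fun _ : ι => 𝓘(ℝ, E)) 𝓘(ℝ, E) (fun x : ι → M => x k) q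
      (ContinuousLinearMap.proj (R := ℝ) (φ := fun _ : ι => E) k) := by
  refine ⟨(continuous_apply k).continuousAt, ?_⟩
  refine HasFDerivWithinAt.congr_of_eventuallyEq
    (ContinuousLinearMap.hasFDerivWithinAt
      (ContinuousLinearMap.proj (R := ℝ) (φ := fun _ : ι => E) k))
    ?_ ?_
  · have ht : (extChartAt 𝓘(ℝ, E) (q k)).target ∈ 𝓝 (extChartAt 𝓘(ℝ, E) (q k) (q k)) :=
      extChartAt_target_mem_nhds _
    have hc : ContinuousAt (fun y : ι → E => y k)
        (extChartAt (ModelWithCorners.pi fun _ : ι => 𝓘(ℝ, E)) q q) :=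
      (continuous_apply k).continuousAt
    have : ∀ᶠ y in 𝓝 (extChartAt (ModelWithCorners.pi fun _ : ι => 𝓘(ℝ, E)) q q),
        y k ∈ (extChartAt 𝓘(ℝ, E) (q k)).target := hc ht
    filter_upwards [mem_nhdsWithin_of_mem_nhds this] with y hy
    exact (extChartAt 𝓘(ℝ, E) (q k)).right_inv hy
  · exact (extChartAt 𝓘(ℝ, E) (q k)).right_inv (mem_extChartAt_target _)

/-- The first variation of the discrete action, for coefficients `a`, `b` that are the partial
derivatives of `L` along the curve. -/
theorem dAction_eq_sum {N : ℕ} {L : M × M → ℝ} {q : Fin (N + 1) → M}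
    (hL : ∀ k : Fin N, MDifferentiableAt (𝓘(ℝ, E).prod 𝓘(ℝ, E)) 𝓘(ℝ, ℝ) L (q k.castSucc, q k.succ))
    {a b : Fin N → (E →L[ℝ] ℝ)} (ha : ∀ k, a k = D₁ E L (q k.castSucc) (q k.succ))
    (hb : ∀ k, b k = D₂ E L (q k.castSucc) (q k.succ)) (δ : Fin (N + 1) → E) :
    dAction (E := E) L q δ = ∑ k : Fin N, (a k (δ k.castSucc) + b k (δ k.succ)) := by
  have he := fun k => (hasMFDerivAt_eval (E := E) q k)
  have hd : ∀ k : Fin N, MDifferentiableAt (ModelWithCorners.pi fun _ : Fin (N + 1) => 𝓘(ℝ, E))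
      𝓘(ℝ, ℝ) (fun x : Fin (N + 1) → M => L (x k.castSucc, x k.succ)) q := fun k =>
    MDifferentiableAt.comp (I' := 𝓘(ℝ, E).prod 𝓘(ℝ, E)) q (hL k)
      ((he _).mdifferentiableAt.prodMk (he _).mdifferentiableAt)
  obtain ⟨d, hd'⟩ : ∃ d : Fin N → ((Fin (N + 1) → E) →L[ℝ] ℝ), ∀ k, d k =
      mfderiv (ModelWithCorners.pi fun _ : Fin (N + 1) => 𝓘(ℝ, E)) 𝓘(ℝ, ℝ)
        (fun x : Fin (N + 1) → M => L (x k.castSucc, x k.succ)) q := ⟨_, fun _ => rfl⟩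
  have hs : HasMFDerivAt (ModelWithCorners.pi fun _ : Fin (N + 1) => 𝓘(ℝ, E)) 𝓘(ℝ, ℝ)
      (action N L) q (∑ k, d k) := by
    have := HasMFDerivAt.sum (t := Finset.univ) (f' := d) (z := q) (f := fun (k : Fin N)
      (x : Fin (N + 1) → M) => L (x k.castSucc, x k.succ))
      (I := ModelWithCorners.pi fun _ : Fin (N + 1) => 𝓘(ℝ, E))
      (fun k _ => by rw [hd' k]; exact (hd k).hasMFDerivAt)
    have e : action N L = ∑ k : Fin N, fun x : Fin (N + 1) → M => L (x k.castSucc, x k.succ) := by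
      ext x
      simp [action]
    rw [e]
    exact this
  have h1 : dAction (E := E) L q δ = (∑ k, d k) δ := congrArg (fun T => T δ) hs.mfderiv
  rw [h1, sum_apply]
  refine Finset.sum_congr rfl fun k _ => ?_
  rw [hd' k, ha k, hb k]
  refine (mfderiv_comp₂_apply (hL k) (he k.castSucc).mdifferentiableAt
    (he k.succ).mdifferentiableAt rfl rfl δ).trans ?_
  rw [(he _).mfderiv, (he _).mfderiv]
  rfl

/-- The forced variational principle is equivalent to the forced discrete Euler–Lagrange
equations. -/
theorem isForcedTrajectory_iff {N : ℕ} {L : M × M → ℝ} {f : Force E M} {q : Fin (N + 1) → M}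
    (hL : ∀ k : Fin N,
      MDifferentiableAt (𝓘(ℝ, E).prod 𝓘(ℝ, E)) 𝓘(ℝ, ℝ) L (q k.castSucc, q k.succ)) :
    IsForcedTrajectory L f q ↔ ForcedDiscreteEulerLagrange L f q := by
  obtain ⟨a, ha⟩ : ∃ a : Fin N → (E →L[ℝ] ℝ),
    ∀ k, a k = D₁ E L (q k.castSucc) (q k.succ) := ⟨_, fun _ => rfl⟩
  obtain ⟨b, hb⟩ : ∃ b : Fin N → (E →L[ℝ] ℝ),
    ∀ k, b k = D₂ E L (q k.castSucc) (q k.succ) := ⟨_, fun _ => rfl⟩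
  obtain ⟨m, hm⟩ : ∃ m : Fin N → (E →L[ℝ] ℝ),
    ∀ k, m k = f.minus (q k.castSucc) (q k.succ) := ⟨_, fun _ => rfl⟩
  obtain ⟨p, hp⟩ : ∃ p : Fin N → (E →L[ℝ] ℝ),
    ∀ k, p k = f.plus (q k.castSucc) (q k.succ) := ⟨_, fun _ => rfl⟩
  have hf : ∀ (k : Fin N) (u v : E), f (q k.castSucc) (q k.succ) (u, v) = m k u + p k v := by
    intro k u v
    rw [hm, hp]
    have : ((u, v) : E × E) = (u, 0) + (0, v) := by simp
    exact (congrArg (f (q k.castSucc) (q k.succ)) this).trans (map_add _ _ _)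
  have h1 : IsForcedTrajectory L f q ↔
      ∀ δ : Fin (N + 1) → E, δ 0 = 0 → δ (Fin.last N) = 0 →
        ∑ k : Fin N, ((a k + m k) (δ k.castSucc) + (b k + p k) (δ k.succ)) = 0 := by
    have : ∀ δ : Fin (N + 1) → E, (dAction (E := E) L q δ =
        - ∑ k : Fin N, f (q k.castSucc) (q k.succ) (δ k.castSucc, δ k.succ)) ↔
        ∑ k : Fin N, ((a k + m k) (δ k.castSucc) + (b k + p k) (δ k.succ)) = 0 := by
      intro δ
      have h2 : ∑ k : Fin N, f (q k.castSucc) (q k.succ) (δ k.castSucc, δ k.succ) =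
          ∑ k : Fin N, (m k (δ k.castSucc) + p k (δ k.succ)) :=
        Finset.sum_congr rfl fun k _ => hf k _ _
      rw [dAction_eq_sum hL ha hb δ, h2, eq_neg_iff_add_eq_zero, ← Finset.sum_add_distrib]
      refine Eq.congr (Finset.sum_congr rfl fun k _ => ?_) rfl
      simp only [add_apply]
      abel
    exact ⟨fun H δ h0 hl => (this δ).1 (H δ ⟨h0, hl⟩),
      fun H δ hδ => (this δ).2 (H δ hδ.1 hδ.2)⟩
  rw [h1, sum_eq_zero_iff_interior]
  refine ⟨fun H k h₂ h₁ h₀ => ?_, fun H k hk => ?_⟩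
  · have := H k (by omega)
    rw [hb, ha, hm, hp] at this
    refine Eq.trans ?_ this
    exact (by intros; abel : ∀ a b c d : E →L[ℝ] ℝ, a + b + c + d = b + c + (a + d)) _ _ _ _
  · have := H k (by omega) (by omega) (by omega)
    rw [hb, ha, hm, hp]
    refine Eq.trans ?_ this
    exact (by intros; abel : ∀ a b c d : E →L[ℝ] ℝ, b + c + (a + d) = a + b + c + d) _ _ _ _

/-- The variational principle is equivalent to the discrete Euler–Lagrange equations; this is the
forced case with zero force. -/
theorem isTrajectory_iff {N : ℕ} {L : M × M → ℝ} {q : Fin (N + 1) → M}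
    (hL : ∀ k : Fin N,
      MDifferentiableAt (𝓘(ℝ, E).prod 𝓘(ℝ, E)) 𝓘(ℝ, ℝ) L (q k.castSucc, q k.succ)) :
    IsTrajectory E L q ↔ DiscreteEulerLagrange E L q := by
  have h := isForcedTrajectory_iff (f := fun _ _ => 0) hL
  refine Iff.trans ?_ (h.trans ?_)
  · refine forall₂_congr fun δ hδ => Eq.congr rfl ?_
    exact (neg_eq_zero.2 (Finset.sum_eq_zero fun _ _ => rfl)).symm
  · refine forall₄_congr fun k h₂ h₁ h₀ => ?_
    refine Eq.congr ?_ rfl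
    exact (by intros; simp [add_comm] : ∀ a b : E →L[ℝ] ℝ,
      a + b + (0 : E × E →L[ℝ] ℝ).comp (.inr ℝ E E) + (0 : E × E →L[ℝ] ℝ).comp (.inl ℝ E E)
        = b + a) _ _

end Variation

/-! ### Actions of Lie groups and invariance -/

section Action

variable {E : Type*} [NormedAddCommGroup E] [NormedSpace ℝ E]
  {F : Type*} [NormedAddCommGroup F] [NormedSpace ℝ F]
  {Q : Type*} [TopologicalSpace Q] [ChartedSpace E Q]
  {K : Type*} [TopologicalSpace K] [ChartedSpace F K] [Group K] [MulAction K Q]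
  [ContMDiffSMul 𝓘(ℝ, F) 𝓘(ℝ, E) ∞ K Q]

theorem mdifferentiable_smul_prod :
    MDifferentiable (𝓘(ℝ, F).prod 𝓘(ℝ, E)) 𝓘(ℝ, E) (fun p : K × Q => p.1 • p.2) :=
  (contMDiff_smul (I := 𝓘(ℝ, F)) (I' := 𝓘(ℝ, E)) (n := ∞)).mdifferentiable (by simp)

theorem mdifferentiable_smul_left (q : Q) :
    MDifferentiable 𝓘(ℝ, F) 𝓘(ℝ, E) (fun g : K => g • q) := fun g =>
  (mdifferentiable_smul_prod (g, q)).comp (I' := 𝓘(ℝ, F).prod 𝓘(ℝ, E)) g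
    (mdifferentiableAt_id.prodMk mdifferentiableAt_const)

theorem mdifferentiable_smul_right (F : Type*) [NormedAddCommGroup F] [NormedSpace ℝ F]
    [ChartedSpace F K] [ContMDiffSMul 𝓘(ℝ, F) 𝓘(ℝ, E) ∞ K Q] (g : K) :
    MDifferentiable 𝓘(ℝ, E) 𝓘(ℝ, E) (fun q : Q => g • q) := fun q =>
  (mdifferentiable_smul_prod (F := F) (g, q)).comp (I' := 𝓘(ℝ, F).prod 𝓘(ℝ, E)) q
    (mdifferentiableAt_const.prodMk mdifferentiableAt_id)

section

variable {EP HP P : Type*} [NormedAddCommGroup EP] [NormedSpace ℝ EP] [TopologicalSpace HP]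
  {IP : ModelWithCorners ℝ EP HP} [TopologicalSpace P] [ChartedSpace HP P]

theorem mdifferentiableAt_smul {a : P → K} {c : P → Q} {p : P}
    (ha : MDifferentiableAt IP 𝓘(ℝ, F) a p) (hc : MDifferentiableAt IP 𝓘(ℝ, E) c p) :
    MDifferentiableAt IP 𝓘(ℝ, E) (fun p => a p • c p) p :=
  (mdifferentiable_smul_prod (a p, c p)).comp (I' := 𝓘(ℝ, F).prod 𝓘(ℝ, E)) p (ha.prodMk hc)

/-- The Leibniz rule for `a(p) • c(p)` at a point where `a = 1`: the group-valued factor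
contributes an infinitesimal generator. -/
theorem mfderiv_smul_apply {a : P → K} {c : P → Q} {p : P} {q : Q}
    (ha : MDifferentiableAt IP 𝓘(ℝ, F) a p) (hc : MDifferentiableAt IP 𝓘(ℝ, E) c p)
    (h1 : a p = 1) (hq : c p = q) (v : EP) :
    (mfderiv IP 𝓘(ℝ, E) (fun p => a p • c p) p : EP →L[ℝ] E) v =
      HAdd.hAdd (α := E) (β := E)
        ((infGen E F K q : F →L[ℝ] E) ((mfderiv IP 𝓘(ℝ, F) a p : EP →L[ℝ] F) v))
        ((mfderiv IP 𝓘(ℝ, E) c p : EP →L[ℝ] E) v) := by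
  refine (mfderiv_comp₂_apply (mdifferentiable_smul_prod (1, q)) ha hc h1 hq v).trans ?_
  have : (fun y : Q => ((1 : K), y).1 • ((1 : K), y).2) = id := by
    ext y
    exact one_smul K y
  rw [this, mfderiv_id]
  rfl

end

variable {L : Q × Q → ℝ}

theorem D₁_smul (F : Type*) [NormedAddCommGroup F] [NormedSpace ℝ F]
    [ChartedSpace F K] [ContMDiffSMul 𝓘(ℝ, F) 𝓘(ℝ, E) ∞ K Q]
    (hL : MDifferentiable (𝓘(ℝ, E).prod 𝓘(ℝ, E)) 𝓘(ℝ, ℝ) L)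
    (hinv : ∀ (g : K) (x y : Q), L (g • x, g • y) = L (x, y)) (g : K) (x y : Q) (u : E) :
    (D₁ E L (g • x) (g • y) : E →L[ℝ] ℝ)
      ((mfderiv 𝓘(ℝ, E) 𝓘(ℝ, E) (fun z : Q => g • z) x : E →L[ℝ] E) u) =
      (D₁ E L x y : E →L[ℝ] ℝ) u := by
  have h := mfderiv_comp_apply (I := 𝓘(ℝ, E)) (I' := 𝓘(ℝ, E)) (I'' := 𝓘(ℝ, ℝ)) x
    (f := fun z : Q => g • z) (g := fun z => L (z, g • y))
    ((hL (g • x, g • y)).comp (I' := 𝓘(ℝ, E).prod 𝓘(ℝ, E)) (g • x)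
      (mdifferentiableAt_id.prodMk mdifferentiableAt_const))
    (mdifferentiable_smul_right F g x) u
  refine h.symm.trans ?_
  have e : ((fun z => L (z, g • y)) ∘ fun z : Q => g • z) = fun z => L (z, y) :=
    funext fun z => hinv g z y
  rw [e]
  rfl

theorem D₂_smul (F : Type*) [NormedAddCommGroup F] [NormedSpace ℝ F]
    [ChartedSpace F K] [ContMDiffSMul 𝓘(ℝ, F) 𝓘(ℝ, E) ∞ K Q]
    (hL : MDifferentiable (𝓘(ℝ, E).prod 𝓘(ℝ, E)) 𝓘(ℝ, ℝ) L)
    (hinv : ∀ (g : K) (x y : Q), L (g • x, g • y) = L (x, y)) (g : K) (x y : Q) (v : E) :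
    (D₂ E L (g • x) (g • y) : E →L[ℝ] ℝ)
      ((mfderiv 𝓘(ℝ, E) 𝓘(ℝ, E) (fun z : Q => g • z) y : E →L[ℝ] E) v) =
      (D₂ E L x y : E →L[ℝ] ℝ) v := by
  have h := mfderiv_comp_apply (I := 𝓘(ℝ, E)) (I' := 𝓘(ℝ, E)) (I'' := 𝓘(ℝ, ℝ)) y
    (f := fun z : Q => g • z) (g := fun z => L (g • x, z))
    ((hL (g • x, g • y)).comp (I' := 𝓘(ℝ, E).prod 𝓘(ℝ, E)) (g • y)
      (mdifferentiableAt_const.prodMk mdifferentiableAt_id))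
    (mdifferentiable_smul_right F g y) v
  refine h.symm.trans ?_
  have e : ((fun z => L (g • x, z)) ∘ fun z : Q => g • z) = fun z => L (x, z) :=
    funext fun z => hinv g x z
  rw [e]
  rfl

/-- The infinitesimal form of the invariance of `L`. -/
theorem D₁_infGen_add_D₂_infGen (hL : MDifferentiable (𝓘(ℝ, E).prod 𝓘(ℝ, E)) 𝓘(ℝ, ℝ) L)
    (hinv : ∀ (g : K) (x y : Q), L (g • x, g • y) = L (x, y)) (x y : Q) (ξ : F) :
    (D₁ E L x y : E →L[ℝ] ℝ) ((infGen E F K x : F →L[ℝ] E) ξ) +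
      (D₂ E L x y : E →L[ℝ] ℝ) ((infGen E F K y : F →L[ℝ] E) ξ) = 0 := by
  have h := mfderiv_comp₂_apply (hL (x, y))
    (mdifferentiable_smul_left (F := F) (K := K) x 1) (mdifferentiable_smul_left (F := F) y 1)
    (one_smul K x) (one_smul K y) ξ
  refine h.symm.trans ?_
  have e : (fun g : K => L (g • x, g • y)) = fun _ => L (x, y) := funext fun g => hinv g x y
  rw [e, mfderiv_const]
  rfl

variable [LieGroup 𝓘(ℝ, F) ∞ K]

/-- Equivariance of the infinitesimal generators. -/
theorem infGen_smul_Ad (g : K) (q : Q) (ξ : F) :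
    (infGen E F K (g • q) : F →L[ℝ] E) ((Ad (E := F) g : F →L[ℝ] F) ξ) =
      (mfderiv 𝓘(ℝ, E) 𝓘(ℝ, E) (fun z : Q => g • z) q : E →L[ℝ] E)
        ((infGen E F K q : F →L[ℝ] E) ξ) := by
  have h1 := mfderiv_comp_apply_of_eq (I := 𝓘(ℝ, F)) (I' := 𝓘(ℝ, F)) (I'' := 𝓘(ℝ, E))
    (f := fun h : K => g * h * g⁻¹) (g := fun h : K => h • (g • q)) (x := 1) (y := 1)
    (mdifferentiable_smul_left (g • q) 1) (mdifferentiableAt_conj g 1) (by simp) ξ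
  have h2 := mfderiv_comp_apply_of_eq (I := 𝓘(ℝ, F)) (I' := 𝓘(ℝ, E)) (I'' := 𝓘(ℝ, E))
    (f := fun h : K => h • q) (g := fun z : Q => g • z) (x := 1) (y := q)
    (mdifferentiable_smul_right F g q) (mdifferentiable_smul_left q 1) (by simp) ξ
  have e : ((fun h : K => h • (g • q)) ∘ fun h : K => g * h * g⁻¹) =
      (fun z : Q => g • z) ∘ fun h : K => h • q := by
    ext h
    simp [smul_smul]
  rw [e] at h1
  exact h1.symm.trans h2

theorem Ad_surjective (g : K) : Function.Surjective (Ad (E := F) g) := fun ξ => by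
  refine ⟨Ad g⁻¹ ξ, ?_⟩
  have h : (Ad (E := F) g).comp (Ad g⁻¹) = ContinuousLinearMap.id ℝ _ := by
    rw [← Ad_mul, mul_inv_cancel, Ad_one]
  exact congrArg (fun T => T ξ) h

/-- For an `Ad`-invariant `ν`, the level set of the momentum map is invariant, by equivariance of
the momentum map. -/
theorem momentumMap_smul_eq_iff (hL : MDifferentiable (𝓘(ℝ, E).prod 𝓘(ℝ, E)) 𝓘(ℝ, ℝ) L)
    (hinv : ∀ (g : K) (x y : Q), L (g • x, g • y) = L (x, y))
    {ν : GroupLieAlgebra 𝓘(ℝ, F) K →L[ℝ] ℝ} (hν : ∀ g : K, ν.comp (Ad g) = ν) (g : K) (x y : Q) :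
    momentumMap E F K L (g • x) (g • y) = ν ↔ momentumMap E F K L x y = ν := by
  have h : ∀ ξ, momentumMap E F K L (g • x) (g • y) (Ad g ξ) = momentumMap E F K L x y ξ := by
    intro ξ
    have h1 : (D₁ E L (g • x) (g • y) : E →L[ℝ] ℝ)
        ((infGen E F K (g • x) : F →L[ℝ] E) ((Ad (E := F) g : F →L[ℝ] F) ξ)) =
        (D₁ E L x y : E →L[ℝ] ℝ) ((infGen E F K x : F →L[ℝ] E) ξ) := by
      exact (congrArg _ (infGen_smul_Ad (F := F) g x ξ)).trans (D₁_smul F hL hinv g x y _)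
    exact congrArg (fun t : ℝ => -t) h1
  constructor
  · intro H
    ext ξ
    rw [← h, H]
    exact congrArg (fun T => T ξ) (hν g)
  · intro H
    ext η
    obtain ⟨ξ, rfl⟩ := Ad_surjective g η
    rw [h, H]
    exact (congrArg (fun T => T ξ) (hν g)).symm

end Action

/-! ### The implicit function theorem on manifolds -/

section Implicit

variable {E₁ : Type*} [NormedAddCommGroup E₁] [NormedSpace ℝ E₁] [CompleteSpace E₁]
  {H₁ : Type*} [TopologicalSpace H₁]
  {I₁ : ModelWithCorners ℝ E₁ H₁} [I₁.Boundaryless]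
  {P : Type*} [TopologicalSpace P] [ChartedSpace H₁ P] [IsManifold I₁ 1 P]
  {E₂ : Type*} [NormedAddCommGroup E₂] [NormedSpace ℝ E₂] [CompleteSpace E₂]
  {H₂ : Type*} [TopologicalSpace H₂]
  {I₂ : ModelWithCorners ℝ E₂ H₂} [I₂.Boundaryless]
  {M : Type*} [TopologicalSpace M] [ChartedSpace H₂ M] [IsManifold I₂ 1 M]
  {V : Type*} [NormedAddCommGroup V] [NormedSpace ℝ V] [CompleteSpace V]

/-- If the derivative of `f` in its second argument is invertible at `(p, x)`, then the equation
`f (z, b z) = f (p, x)` has a solution `b` near `p` that is differentiable at `p` and takes the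
value `x` there. -/
theorem exists_implicit_function {f : P × M → V} {p : P} {x : M}
    (hf : ContMDiffAt (I₁.prod I₂) 𝓘(ℝ, V) 1 f (p, x))
    {A : E₂ →L[ℝ] V} (hA : A = mfderiv I₂ 𝓘(ℝ, V) (fun y => f (p, y)) x) (hinv : A.IsInvertible) :
    ∃ b : P → M, MDifferentiableAt I₁ I₂ b p ∧ b p = x ∧ ∀ᶠ z in 𝓝 p, f (z, b z) = f (p, x) := by
  -- `f'` is `f` in the charts at `p` and `x`
  set φ := extChartAt I₁ p
  set ψ := extChartAt I₂ x
  set f' : E₁ × E₂ → V := fun w => f (φ.symm w.1, ψ.symm w.2) with hf'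
  have hC : ContDiffAt ℝ 1 f' (φ p, ψ x) := by
    have h := (contMDiffAt_iff.1 hf).2
    rw [ModelWithCorners.range_eq_univ, contDiffWithinAt_univ, extChartAt_prod] at h
    exact h
  have hd : fderiv ℝ f' (φ p, ψ x) ∘L .inr ℝ E₁ E₂ = A := by
    have h1 : HasFDerivAt (fun v : E₂ => f' (φ p, v))
        (fderiv ℝ f' (φ p, ψ x) ∘L .inr ℝ E₁ E₂) (ψ x) :=
      HasFDerivAt.comp (ψ x) (hC.differentiableAt (by simp)).hasFDerivAt
        (hasFDerivAt_prodMk_right (φ p) (ψ x))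
    have h2 : MDifferentiableAt I₂ 𝓘(ℝ, V) (fun y => f (p, y)) x :=
      (hf.mdifferentiableAt (by simp)).comp (I' := I₁.prod I₂) x
        (mdifferentiableAt_const.prodMk mdifferentiableAt_id)
    have h3 : HasFDerivWithinAt (𝕜 := ℝ) (E := E₂) (F := V)
        (writtenInExtChartAt I₂ 𝓘(ℝ, V) x (fun y => f (p, y))) A (Set.range I₂) (ψ x) := by
      rw [hA]
      exact h2.hasMFDerivAt.2
    rw [ModelWithCorners.range_eq_univ, hasFDerivWithinAt_univ] at h3
    refine h1.unique (h3.congr_of_eventuallyEq (Eventually.of_forall fun v => ?_))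
    have : φ.symm (φ p) = p := φ.left_inv (mem_extChartAt_source p)
    simp only [hf', this]
    rfl
  have hinv' : (fderiv ℝ f' (φ p, ψ x) ∘L .inr ℝ E₁ E₂).IsInvertible := by rwa [hd]
  set g := hC.implicitFunction one_ne_zero hinv'
  have hg0 : g (φ p) = ψ x := hC.implicitFunction_apply_self one_ne_zero hinv'
  have hgd : DifferentiableAt ℝ g (φ p) :=
    (hC.hasStrictFDerivAt_implicitFunction one_ne_zero hinv').hasFDerivAt.differentiableAt
  have hge : ∀ᶠ u in 𝓝 (φ p), f' (u, g u) = f' (φ p, ψ x) :=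
    hC.eventually_apply_implicitFunction one_ne_zero hinv'
  have hφ : MDifferentiableAt I₁ 𝓘(ℝ, E₁) φ p := mdifferentiableAt_extChartAt (mem_chart_source _ p)
  have hψ : MDifferentiableAt 𝓘(ℝ, E₂) I₂ ψ.symm (ψ x) := by
    have := mdifferentiableWithinAt_extChartAt_symm (I := I₂) (mem_extChartAt_target (I := I₂) x)
    rwa [ModelWithCorners.range_eq_univ, mdifferentiableWithinAt_univ] at this
  refine ⟨fun z => ψ.symm (g (φ z)), ?_, ?_, ?_⟩
  · have h1 : MDifferentiableAt I₁ 𝓘(ℝ, E₂) (fun z => g (φ z)) p :=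
      hgd.mdifferentiableAt.comp (I' := 𝓘(ℝ, E₁)) p hφ
    exact MDifferentiableAt.comp_of_eq (I' := 𝓘(ℝ, E₂)) p hψ h1 hg0
  · simp only [hg0]
    exact ψ.left_inv (mem_extChartAt_source x)
  · have h1 : ∀ᶠ z in 𝓝 p, f' (φ z, g (φ z)) = f' (φ p, ψ x) :=
      (continuousAt_extChartAt p).eventually hge
    filter_upwards [h1, extChartAt_source_mem_nhds (I := I₁) p] with z hz hzs
    have e1 : φ.symm (φ z) = z := φ.left_inv hzs
    have e2 : φ.symm (φ p) = p := φ.left_inv (mem_extChartAt_source p)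
    have e3 : ψ.symm (ψ x) = x := ψ.left_inv (mem_extChartAt_source x)
    simpa only [hf', e1, e2, e3] using hz

end Implicit

section Parametric

variable {E₁ : Type*} [NormedAddCommGroup E₁] [NormedSpace ℝ E₁]
  {H₁ : Type*} [TopologicalSpace H₁] {I₁ : ModelWithCorners ℝ E₁ H₁}
  {P : Type*} [TopologicalSpace P] [ChartedSpace H₁ P] [IsManifold I₁ 1 P]
  {E₂ : Type*} [NormedAddCommGroup E₂] [NormedSpace ℝ E₂]
  {H₂ : Type*} [TopologicalSpace H₂] {I₂ : ModelWithCorners ℝ E₂ H₂}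
  {M : Type*} [TopologicalSpace M] [ChartedSpace H₂ M] [IsManifold I₂ 1 M]

/-- A differential in the direction of one factor, at a fixed base point of that factor, depends
smoothly on the parameters. -/
theorem contMDiff_mfderiv_parametric
    {f : P → M → ℝ} (hf : ContMDiff (I₁.prod I₂) 𝓘(ℝ, ℝ) ∞ (Function.uncurry f)) (x : M)
    {D : P → (E₂ →L[ℝ] ℝ)} (hD : ∀ p, D p = mfderiv I₂ 𝓘(ℝ, ℝ) (f p) x) :
    ContMDiff I₁ 𝓘(ℝ, E₂ →L[ℝ] ℝ) 1 D := by
  intro p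
  have h2 : (1 : WithTop ℕ∞) + 1 ≤ ∞ := by
    rw [one_add_one_eq_two]
    exact ENat.LEInfty.out
  have h : ContMDiffAt I₁ 𝓘(ℝ, E₂ →L[ℝ] ℝ) 1 (inTangentCoordinates I₂ 𝓘(ℝ, ℝ)
      (fun _ => x) (fun p => f p x) D p) p := by
    rw [funext hD]
    exact ContMDiffAt.mfderiv (m := 1) (n := ∞) f (fun _ => x)
      (hf (p, x)) contMDiffAt_const h2
  refine h.congr_of_eventuallyEq (Eventually.of_forall fun p' => ?_)
  rw [inTangentCoordinates_eq (x₀ := p) (x := p') (fun _ => x) (fun p => f p x) D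
    (mem_chart_source H₂ x) (Set.mem_univ _)]
  -- both changes of coordinates are trivial: the base point is fixed, and the target is `ℝ`
  ext v
  have h1 := (tangentBundleCore I₂ M).coordChange_self (achart H₂ x) x (mem_chart_source H₂ x) v
  have h2 := tangentBundleCore_coordChange_model_space (I := 𝓘(ℝ, ℝ)) (f p' x) (f p x) (f p' x)
  have h3 : ∀ v, ((tangentBundleCore 𝓘(ℝ, ℝ) ℝ).coordChange (achart ℝ (f p' x))
      (achart ℝ (f p x)) (f p' x)) v = v := by
    intro v
    rw [h2]; rfl
  exact ((h3 _).trans (congrArg _ h1)).symm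

end Parametric

/-! ### The affine discrete connection -/

section Connection

variable {E : Type*} [NormedAddCommGroup E] [NormedSpace ℝ E]
  {F : Type*} [NormedAddCommGroup F] [NormedSpace ℝ F]
  {Q : Type*} [TopologicalSpace Q] [ChartedSpace E Q]
  {K : Type*} [TopologicalSpace K] [ChartedSpace F K] [Group K] [MulAction K Q]
  {L : Q × Q → ℝ} {ν : GroupLieAlgebra 𝓘(ℝ, F) K →L[ℝ] ℝ}

/-- On each orbit there is at most one point that forms a pair of momentum `ν` with `x`. -/
theorem IsGoodSymmetry.eq_of_mem_level (good : IsGoodSymmetry E L ν) {x y : Q} {g h : K}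
    (hg : (x, g • y) ∈ momentumLevel E L ν) (hh : (x, h • y) ∈ momentumLevel E L ν) : g = h := by
  have := good.eq_one x (h • y) (g * h⁻¹) hh (by rwa [smul_smul, inv_mul_cancel_right])
  rwa [mul_inv_eq_one] at this

theorem IsGoodSymmetry.affineConnection_eq (good : IsGoodSymmetry E L ν) {x y : Q} {g : K}
    (hg : (x, g⁻¹ • y) ∈ momentumLevel E L ν) : affineConnection E L ν (x, y) = g := by
  have h := Classical.epsilon_spec (p := fun g : K => (x, g⁻¹ • y) ∈ momentumLevel E L ν) ⟨g, hg⟩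
  exact inv_injective (good.eq_of_mem_level h hg)

theorem IsGoodSymmetry.discreteLift_eq (good : IsGoodSymmetry E L ν) {x y : Q}
    (h : (x, y) ∈ momentumLevel E L ν) : discreteLift E L ν x (proj K y) = y := by
  have hs : (x, discreteLift E L ν x (proj K y)) ∈ momentumLevel E L ν ∧
      proj K (discreteLift E L ν x (proj K y)) = proj K y :=
    @Classical.epsilon_spec_aux Q ⟨x⟩
      (fun q₁ => (x, q₁) ∈ momentumLevel E L ν ∧ proj K q₁ = proj K y) ⟨y, h, rfl⟩
  obtain ⟨g, hg⟩ : ∃ g : K, g • y = discreteLift E L ν x (proj K y) :=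
    MulAction.orbitRel_apply.1 (Quotient.exact hs.2)
  have h1 : g = 1 := good.eq_one x y g h (by rw [hg]; exact hs.1)
  rw [← hg, h1, one_smul]

variable [ContMDiffSMul 𝓘(ℝ, F) 𝓘(ℝ, E) ∞ K Q]

/-- The momentum map as a differential at the fixed base point `1` of the group, where smooth
dependence on the parameters can be expressed without changes of coordinates. -/
theorem momentumMap_eq_mfderiv (hL : MDifferentiable (𝓘(ℝ, E).prod 𝓘(ℝ, E)) 𝓘(ℝ, ℝ) L) (x y : Q) :
    (momentumMap E F K L x y : F →L[ℝ] ℝ) =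
      mfderiv 𝓘(ℝ, F) 𝓘(ℝ, ℝ) (fun h : K => -L (h • x, y)) 1 := by
  have hd : MDifferentiableAt 𝓘(ℝ, E) 𝓘(ℝ, ℝ) (fun x' => L (x', y)) x :=
    (hL (x, y)).comp (I' := 𝓘(ℝ, E).prod 𝓘(ℝ, E)) x
      (mdifferentiableAt_id.prodMk mdifferentiableAt_const)
  have h2 := mfderiv_neg (I := 𝓘(ℝ, F)) (f := fun h : K => L (h • x, y)) (x := 1)
  ext ξ
  have h1 := mfderiv_comp_apply_of_eq (I := 𝓘(ℝ, F)) (I' := 𝓘(ℝ, E)) (I'' := 𝓘(ℝ, ℝ))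
    (f := fun h : K => h • x) (g := fun x' => L (x', y)) (x := 1) (y := x) hd
    (mdifferentiable_smul_left (F := F) x 1) (one_smul K x) ξ
  exact ((congrArg (fun T : F →L[ℝ] ℝ => T ξ) h2).trans (congrArg (fun t : ℝ => -t) h1)).symm

variable [LieGroup 𝓘(ℝ, F) ∞ K] [FiniteDimensional ℝ E] [FiniteDimensional ℝ F]
  [IsManifold 𝓘(ℝ, E) ∞ Q]

/-- A bilinear form on a finite-dimensional space with trivial left kernel is nondegenerate. -/
theorem isInvertible_of_injective_dual {A : F →L[ℝ] F →L[ℝ] ℝ}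
    (hA : ∀ η, A η = 0 → η = 0) : A.IsInvertible := by
  have hinj : Function.Injective (A : F →ₗ[ℝ] F →L[ℝ] ℝ) :=
    (injective_iff_map_eq_zero _).2 hA
  have hr : Module.finrank ℝ F = Module.finrank ℝ (F →L[ℝ] ℝ) := by
    rw [← (LinearMap.toContinuousLinearMap (𝕜 := ℝ) (E := F) (F' := ℝ)).finrank_eq]
    exact (Subspace.dual_finrank_eq (K := ℝ) (V := F)).symm
  refine ⟨(LinearEquiv.ofInjectiveOfFinrankEq _ hinj hr).toContinuousLinearEquiv, ?_⟩
  ext x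
  rfl

/-- Near a pair of momentum `ν`, pairs can be brought to momentum `ν` by a differentiable
translation of their second point: the equation for the translation can be solved by the implicit
function theorem, because its linearization is the form `D₂D₁L` on vertical vectors. -/
theorem IsGoodSymmetry.exists_translation (good : IsGoodSymmetry E L ν)
    (hL : ContMDiff (𝓘(ℝ, E).prod 𝓘(ℝ, E)) 𝓘(ℝ, ℝ) ∞ L)
    (hinj : ∀ q : Q, Function.Injective (infGen E F K q)) {x y : Q}
    (hxy : (x, y) ∈ momentumLevel E L ν) :
    ∃ b : Q × Q → K, MDifferentiableAt (𝓘(ℝ, E).prod 𝓘(ℝ, E)) 𝓘(ℝ, F) b (x, y) ∧ b (x, y) = 1 ∧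
      ∀ᶠ p in 𝓝 (x, y), (p.1, b p • p.2) ∈ momentumLevel E L ν := by
  have hLd : MDifferentiable (𝓘(ℝ, E).prod 𝓘(ℝ, E)) 𝓘(ℝ, ℝ) L := hL.mdifferentiable (by simp)
  let f : (Q × Q) × K → (F →L[ℝ] ℝ) := fun z => momentumMap E F K L z.1.1 (z.2 • z.1.2)
  have hf : ContMDiff ((𝓘(ℝ, E).prod 𝓘(ℝ, E)).prod 𝓘(ℝ, F)) 𝓘(ℝ, F →L[ℝ] ℝ) 1 f := by
    refine contMDiff_mfderiv_parametric (I₂ := 𝓘(ℝ, F)) (M := K)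
      (f := fun (z : (Q × Q) × K) (h : K) => -L (h • z.1.1, z.2 • z.1.2)) ?_ 1
      (fun z => momentumMap_eq_mfderiv hLd _ _)
    have hs := contMDiff_smul (I := 𝓘(ℝ, F)) (I' := 𝓘(ℝ, E)) (n := ∞) (G := K) (M := Q)
    refine ContMDiff.neg (hL.comp (ContMDiff.prodMk ?_ ?_))
    · exact hs.comp (contMDiff_snd.prodMk (contMDiff_fst.comp (contMDiff_fst.comp contMDiff_fst)))
    · exact hs.comp ((contMDiff_snd.comp contMDiff_fst).prodMk
        (contMDiff_snd.comp (contMDiff_fst.comp contMDiff_fst)))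
  obtain ⟨A, hA⟩ : ∃ A : F →L[ℝ] (F →L[ℝ] ℝ), A =
      mfderiv 𝓘(ℝ, F) 𝓘(ℝ, F →L[ℝ] ℝ) (fun g : K => f ((x, y), g)) 1 := ⟨_, rfl⟩
  have hAv : ∀ η ξ : F, A η ξ = -D₂D₁ L x y (infGen E F K x ξ) (infGen E F K y η) := by
    intro η ξ
    have hfg : MDifferentiableAt 𝓘(ℝ, F) 𝓘(ℝ, F →L[ℝ] ℝ) (fun g : K => f ((x, y), g)) 1 :=
      (hf.mdifferentiable (by simp) ((x, y), 1)).comp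
        (I' := (𝓘(ℝ, E).prod 𝓘(ℝ, E)).prod 𝓘(ℝ, F)) 1
        (mdifferentiableAt_const.prodMk mdifferentiableAt_id)
    have h1 : A η ξ = (mfderiv 𝓘(ℝ, F) 𝓘(ℝ, ℝ) (fun g : K => f ((x, y), g) ξ) 1 : F →L[ℝ] ℝ) η := by
      have := mfderiv_comp_apply (I := 𝓘(ℝ, F)) (I' := 𝓘(ℝ, F →L[ℝ] ℝ)) (I'' := 𝓘(ℝ, ℝ)) (1 : K)
        (f := fun g : K => f ((x, y), g)) (g := ContinuousLinearMap.apply ℝ ℝ ξ)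
        (ContinuousLinearMap.mdifferentiableAt _) hfg η
      refine Eq.trans ?_ this.symm
      rw [hA, ContinuousLinearMap.mfderiv_eq]
      rfl
    -- regularity of `L` provides the differentiability of `y' ↦ D₁L(x, y')` as a covector
    have hu : MDifferentiableAt 𝓘(ℝ, E) 𝓘(ℝ, ℝ)
        (fun y' => D₁ E L x y' (infGen E F K x ξ)) y := by
      obtain ⟨u, hu⟩ : ∃ u : Q → (E →L[ℝ] ℝ), ∀ y', u y' = -D₁ E L x y' := ⟨_, fun _ => rfl⟩
      obtain ⟨e, he⟩ : ∃ e : E, e = infGen E F K x ξ := ⟨_, rfl⟩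
      have h2 : MDifferentiableAt 𝓘(ℝ, E) 𝓘(ℝ, E →L[ℝ] ℝ) u y := by
        rw [funext hu]
        exact (good.regular.2 x).contMDiff.mdifferentiable (by simp) y
      have h3 := (ContinuousLinearMap.mdifferentiableAt (x := u y)
        (-ContinuousLinearMap.apply ℝ ℝ e)).comp (I' := 𝓘(ℝ, E →L[ℝ] ℝ)) y h2
      refine h3.congr_of_eventuallyEq (Eventually.of_forall fun y' => ?_)
      have h4 : D₁ E L x y' e = -u y' e := by
        rw [hu]
        exact (neg_neg _).symm
      rw [← he]
      exact h4
    have h4 := mfderiv_comp_apply_of_eq (I := 𝓘(ℝ, F)) (I' := 𝓘(ℝ, E)) (I'' := 𝓘(ℝ, ℝ))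
      (f := fun g : K => g • y) (g := fun y' => D₁ E L x y' (infGen E F K x ξ)) (x := 1) (y := y)
      hu (mdifferentiable_smul_left (F := F) y 1) (one_smul K y) η
    have h5 := mfderiv_neg (I := 𝓘(ℝ, F))
      (f := fun g : K => D₁ E L x (g • y) (infGen E F K x ξ)) (x := 1)
    rw [h1]
    refine (congrArg (fun T : F →L[ℝ] ℝ => T η) h5).trans ?_
    exact congrArg (fun t : ℝ => -t) h4
  have hinv : A.IsInvertible := by
    refine isInvertible_of_injective_dual fun η hη => ?_
    have h0 : infGen E F K y η = 0 := by
      refine (good.groupRegular x y).2 _ ⟨η, rfl⟩ ?_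
      rintro _ ⟨ξ, rfl⟩
      have := hAv η ξ
      rw [hη] at this
      exact neg_eq_zero.1 this.symm
    exact hinj y (h0.trans (map_zero _).symm)
  obtain ⟨b, hb, hb1, hbe⟩ := exists_implicit_function (hf ((x, y), 1)) hA hinv
  refine ⟨b, hb, hb1, ?_⟩
  filter_upwards [hbe] with p hp
  have h1 : f ((x, y), 1) = ν := by
    show momentumMap E F K L x ((1 : K) • y) = ν
    rw [one_smul]
    exact hxy
  exact hp.trans h1

/-- The affine discrete connection is differentiable on the momentum level set, and defined near
it. -/
theorem IsGoodSymmetry.affineConnection_spec (good : IsGoodSymmetry E L ν)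
    (hL : ContMDiff (𝓘(ℝ, E).prod 𝓘(ℝ, E)) 𝓘(ℝ, ℝ) ∞ L)
    (hinj : ∀ q : Q, Function.Injective (infGen E F K q)) {x y : Q}
    (hxy : (x, y) ∈ momentumLevel E L ν) :
    MDifferentiableAt (𝓘(ℝ, E).prod 𝓘(ℝ, E)) 𝓘(ℝ, F) (affineConnection E L ν) (x, y) ∧
      affineConnection E L ν (x, y) = 1 ∧
      ∀ᶠ p in 𝓝 (x, y), (p.1, (affineConnection E L ν p)⁻¹ • p.2) ∈ momentumLevel E L ν := by
  obtain ⟨b, hb, hb1, hbe⟩ := good.exists_translation hL hinj hxy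
  have he : ∀ᶠ p in 𝓝 (x, y), affineConnection E L ν p = (b p)⁻¹ := by
    filter_upwards [hbe] with p hp
    exact good.affineConnection_eq (by rwa [inv_inv])
  refine ⟨?_, ?_, ?_⟩
  · refine MDifferentiableAt.congr_of_eventuallyEq ?_ he
    exact ((contMDiff_inv 𝓘(ℝ, F) ∞).mdifferentiable (by simp) (b (x, y))).comp
      (I' := 𝓘(ℝ, F)) (x, y) hb
  · exact good.affineConnection_eq (by rwa [inv_one, one_smul])
  · filter_upwards [hbe, he] with p hp hp'
    rwa [hp', inv_inv]

end Connection

/-! ### Local sections of submersions -/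

section Submersion

variable {E₁ : Type*} [NormedAddCommGroup E₁] [NormedSpace ℝ E₁]
  {H₁ : Type*} [TopologicalSpace H₁]
  {I₁ : ModelWithCorners ℝ E₁ H₁} [I₁.Boundaryless]
  {M : Type*} [TopologicalSpace M] [ChartedSpace H₁ M]
  {E₂ : Type*} [NormedAddCommGroup E₂] [NormedSpace ℝ E₂]
  {H₂ : Type*} [TopologicalSpace H₂]
  {I₂ : ModelWithCorners ℝ E₂ H₂}
  {N : Type*} [TopologicalSpace N] [ChartedSpace H₂ N]

/-- In charts where a submersion is the projection `(u, c) ↦ u`, a section is `u ↦ (u, c)` with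
`c` fixed. -/
theorem exists_local_section {f : M → N} {x : M} {y : N}
    (h : Manifold.IsSubmersionAt I₁ I₂ ∞ f x) (hy : f x = y) :
    ∃ σ : N → M, MDifferentiableAt I₂ I₁ σ y ∧ σ y = x ∧ ∀ᶠ z in 𝓝 y, f (σ z) = z := by
  subst hy
  set φ := h.domChart.extend I₁ with hφ
  set ψ := h.codChart.extend I₂ with hψ
  have hxs : x ∈ φ.source := by
    rw [hφ, OpenPartialHomeomorph.extend_source]
    exact h.mem_domChart_source
  have hfs : f x ∈ ψ.source := by
    rw [hψ, OpenPartialHomeomorph.extend_source]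
    exact h.mem_codChart_source
  set c := (h.equiv (φ x)).2 with hc
  set l : E₂ → E₁ := fun w => h.equiv.symm (w, c) with hl
  have hw : ∀ u ∈ φ.target, ψ (f (φ.symm u)) = (h.equiv u).1 := fun u hu => h.writtenInCharts hu
  have hlx : l (ψ (f x)) = φ x := by
    have h1 : ψ (f x) = (h.equiv (φ x)).1 := by
      rw [← hw _ (φ.map_source hxs), φ.left_inv hxs]
    simp only [hl]
    rw [h1, hc, Prod.mk.eta, ContinuousLinearEquiv.symm_apply_apply]
  have hld : Differentiable ℝ l :=
    h.equiv.symm.differentiable.comp (differentiable_id.prodMk (differentiable_const c))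
  have hψd : MDifferentiableAt I₂ 𝓘(ℝ, E₂) ψ (f x) :=
    (I₂.contMDiff.contMDiffAt.comp (f x)
      (contMDiffAt_of_mem_maximalAtlas h.codChart_mem_maximalAtlas
        h.mem_codChart_source)).mdifferentiableAt (n := ∞) (by simp)
  have htn : φ.target ∈ 𝓝 (φ x) := by
    have := h.domChart.extend_target_mem_nhdsWithin (I := I₁) h.mem_domChart_source
    rwa [ModelWithCorners.range_eq_univ, nhdsWithin_univ] at this
  have hφd : MDifferentiableAt 𝓘(ℝ, E₁) I₁ φ.symm (φ x) :=
    ((contMDiffOn_extend_symm h.domChart_mem_maximalAtlas).contMDiffAt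
      (by rwa [hφ, OpenPartialHomeomorph.extend_target'] at htn)).mdifferentiableAt (by simp)
  have hlψ : MDifferentiableAt I₂ 𝓘(ℝ, E₁) (fun z => l (ψ z)) (f x) :=
    (hld _).mdifferentiableAt.comp (I' := 𝓘(ℝ, E₂)) (f x) hψd
  refine ⟨fun z => φ.symm (l (ψ z)), ?_, ?_, ?_⟩
  · exact MDifferentiableAt.comp_of_eq (I' := 𝓘(ℝ, E₁)) (f x) hφd hlψ hlx
  · simp only [hlx]
    exact φ.left_inv hxs
  · have h1 : ∀ᶠ z in 𝓝 (f x), l (ψ z) ∈ φ.target :=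
      hlψ.continuousAt (by rw [hlx]; exact htn)
    have h2 : ∀ᶠ z in 𝓝 (f x), z ∈ ψ.source := by
      rw [hψ, OpenPartialHomeomorph.extend_source]
      exact h.codChart.open_source.mem_nhds h.mem_codChart_source
    filter_upwards [h1, h2] with z hz hz2
    have hs : φ.symm (l (ψ z)) ∈ h.domChart.source := by
      have := φ.map_target hz
      rwa [hφ, OpenPartialHomeomorph.extend_source] at this
    refine ψ.injOn ?_ hz2 ?_
    · rw [hψ, OpenPartialHomeomorph.extend_source]
      exact h.source_subset_preimage_source hs
    · rw [hw _ hz]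
      simp only [hl, ContinuousLinearEquiv.apply_symm_apply]

end Submersion

/-! ### Vertical and horizontal vectors -/

/-- The setting of the reduction: a smooth discrete Lagrangian `L` with the `ν`-good symmetry group
`K`, for a momentum `ν` that is invariant under the coadjoint action of `K`, and the submersion
`Q → Q/K`. -/
structure IsRouthSystem (E : Type*) [NormedAddCommGroup E] [NormedSpace ℝ E]
    {F : Type*} [NormedAddCommGroup F] [NormedSpace ℝ F]
    (B : Type*) [NormedAddCommGroup B] [NormedSpace ℝ B]
    {Q : Type*} [TopologicalSpace Q] [ChartedSpace E Q]
    {K : Type*} [TopologicalSpace K] [ChartedSpace F K] [Group K] [MulAction K Q]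
    [ChartedSpace B (MulAction.orbitRel.Quotient K Q)]
    (L : Q × Q → ℝ) (ν : GroupLieAlgebra 𝓘(ℝ, F) K →L[ℝ] ℝ) : Prop where
  smooth : ContMDiff (𝓘(ℝ, E).prod 𝓘(ℝ, E)) 𝓘(ℝ, ℝ) ∞ L
  good : IsGoodSymmetry E L ν
  comp_Ad : ∀ g : K, ν.comp (Ad g) = ν
  submersion : Manifold.IsSubmersion 𝓘(ℝ, E) 𝓘(ℝ, B) ∞ (proj K : Q → _)

theorem proj_smul {Q : Type*} {K : Type*} [Group K] [MulAction K Q] (g : K) (q : Q) :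
    proj K (g • q) = proj K q :=
  Quotient.sound (MulAction.orbitRel_apply.2 ⟨g, rfl⟩)

theorem exists_smul_eq_of_proj_eq {Q : Type*} {K : Type*} [Group K] [MulAction K Q] {x y : Q}
    (h : proj K x = proj K y) : ∃ g : K, g • y = x :=
  MulAction.orbitRel_apply.1 (Quotient.exact h)

theorem infGen_injective {E : Type*} [NormedAddCommGroup E] [NormedSpace ℝ E]
    {F : Type*} [NormedAddCommGroup F] [NormedSpace ℝ F]
    {Q : Type*} [TopologicalSpace Q] [ChartedSpace E Q] [IsManifold 𝓘(ℝ, E) 1 Q]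
    {K : Type*} [TopologicalSpace K] [ChartedSpace F K] [Group K] [MulAction K Q]
    (𝔄 : PrincipalConnection E F K Q) (q : Q) : Function.Injective (infGen E F K q) :=
  Function.LeftInverse.injective (g := 𝔄.form q) (𝔄.form_infGen q)

section Horizontal

variable {E : Type*} [NormedAddCommGroup E] [NormedSpace ℝ E]
  {F : Type*} [NormedAddCommGroup F] [NormedSpace ℝ F]
  {B : Type*} [NormedAddCommGroup B] [NormedSpace ℝ B]
  {Q : Type*} [TopologicalSpace Q] [ChartedSpace E Q]
  {K : Type*} [TopologicalSpace K] [ChartedSpace F K] [Group K] [MulAction K Q]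
  [ChartedSpace B (MulAction.orbitRel.Quotient K Q)]
  {L : Q × Q → ℝ} {ν : GroupLieAlgebra 𝓘(ℝ, F) K →L[ℝ] ℝ}

namespace IsRouthSystem

theorem mdifferentiable (S : IsRouthSystem E B L ν) :
    MDifferentiable (𝓘(ℝ, E).prod 𝓘(ℝ, E)) 𝓘(ℝ, ℝ) L :=
  S.smooth.mdifferentiable (by simp)

theorem mdifferentiable_proj (S : IsRouthSystem E B L ν) :
    MDifferentiable 𝓘(ℝ, E) 𝓘(ℝ, B) (proj K : Q → _) := fun q =>
  (S.submersion.isSubmersionAt q).contMDiffAt.mdifferentiableAt (by simp)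

theorem exists_mfderiv_proj_eq (S : IsRouthSystem E B L ν) (q : Q) (w : B) :
    ∃ v : E, (mfderiv 𝓘(ℝ, E) 𝓘(ℝ, B) (proj K) q : E →L[ℝ] B) v = w := by
  obtain ⟨σ, hσ, hσq, hσe⟩ := exists_local_section (S.submersion.isSubmersionAt q) rfl
  refine ⟨(mfderiv 𝓘(ℝ, B) 𝓘(ℝ, E) σ (proj K q) : B →L[ℝ] E) w, ?_⟩
  have h := mfderiv_comp_apply_of_eq (I := 𝓘(ℝ, B)) (I' := 𝓘(ℝ, E)) (I'' := 𝓘(ℝ, B))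
    (f := σ) (g := proj K) (x := proj K q) (y := q) (S.mdifferentiable_proj q) hσ hσq w
  have he : (proj K ∘ σ) =ᶠ[𝓝 (proj K q)] id := hσe
  refine h.symm.trans ?_
  have h2 := (mdifferentiableAt_id.hasMFDerivAt.congr_of_eventuallyEq (I := 𝓘(ℝ, B)) he).mfderiv
  refine (congrArg (fun T : B →L[ℝ] B => T w) h2).trans ?_
  exact congrArg (fun T : B →L[ℝ] B => T w) mfderiv_id

variable [ContMDiffSMul 𝓘(ℝ, F) 𝓘(ℝ, E) ∞ K Q]

theorem mfderiv_proj_infGen (S : IsRouthSystem E B L ν) (q : Q) (ξ : F) :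
    (mfderiv 𝓘(ℝ, E) 𝓘(ℝ, B) (proj K) q : E →L[ℝ] B) ((infGen E F K q : F →L[ℝ] E) ξ) = 0 := by
  have h := mfderiv_comp_apply_of_eq (I := 𝓘(ℝ, F)) (I' := 𝓘(ℝ, E)) (I'' := 𝓘(ℝ, B))
    (f := fun h : K => h • q) (g := proj K) (x := 1) (y := q)
    (S.mdifferentiable_proj q) (mdifferentiable_smul_left (F := F) q 1) (one_smul K q) ξ
  refine h.symm.trans ?_
  have e : (proj K ∘ fun h : K => h • q) = fun _ => proj K q := funext fun h => proj_smul h q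
  rw [e, mfderiv_const]
  rfl

variable [LieGroup 𝓘(ℝ, F) ∞ K]

theorem smul_mem_level (S : IsRouthSystem E B L ν) {x y : Q} (g : K)
    (h : (x, y) ∈ momentumLevel E L ν) : (g • x, g • y) ∈ momentumLevel E L ν :=
  (momentumMap_smul_eq_iff S.mdifferentiable S.good.invariant S.comp_Ad g x y).2 h

/-- Every point is the second point of a pair of momentum `ν`. -/
theorem exists_mem_level (S : IsRouthSystem E B L ν) (y : Q) :
    ∃ x, (x, y) ∈ momentumLevel E L ν := by
  obtain ⟨g, hg, -⟩ := S.good.existsUnique_level y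
  refine ⟨g⁻¹ • y, ?_⟩
  simpa using S.smul_mem_level g⁻¹ hg

variable [FiniteDimensional ℝ E] [FiniteDimensional ℝ F] [IsManifold 𝓘(ℝ, E) ∞ Q]

/-- The kernel of `T_yπ` consists of vertical vectors. For `x` with `(x, y)` of momentum `ν`, the
points near `y` are `z = 𝒜(x, z) • s(π(z))`, where `s(τ)` is the discrete horizontal lift of `τ` at
`x`; differentiating at `y` in a direction killed by `T_yπ` leaves an infinitesimal generator. -/
theorem exists_infGen_eq (S : IsRouthSystem E B L ν)
    (hinj : ∀ q : Q, Function.Injective (infGen E F K q)) (y : Q) {v : E}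
    (hv : (mfderiv 𝓘(ℝ, E) 𝓘(ℝ, B) (proj K) y : E →L[ℝ] B) v = 0) :
    ∃ ξ : F, (infGen E F K y : F →L[ℝ] E) ξ = v := by
  obtain ⟨x, hxy⟩ := S.exists_mem_level y
  obtain ⟨σ, hσ, hσy, hσe⟩ := exists_local_section (S.submersion.isSubmersionAt y) rfl
  obtain ⟨hA, hA1, hAe⟩ := S.good.affineConnection_spec S.smooth hinj hxy
  set a : Q → K := fun z => affineConnection E L ν (x, z) with ha
  have had : MDifferentiableAt 𝓘(ℝ, E) 𝓘(ℝ, F) a y :=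
    hA.comp (I' := 𝓘(ℝ, E).prod 𝓘(ℝ, E)) y (mdifferentiableAt_const.prodMk mdifferentiableAt_id)
  have hae : ∀ᶠ z in 𝓝 y, (x, (a z)⁻¹ • z) ∈ momentumLevel E L ν := by
    have hc : ContinuousAt (fun z : Q => (x, z)) y := by fun_prop
    exact hc.eventually hAe
  set s : MulAction.orbitRel.Quotient K Q → Q := fun τ => (a (σ τ))⁻¹ • σ τ with hs
  have hsd : MDifferentiableAt 𝓘(ℝ, B) 𝓘(ℝ, E) s (proj K y) := by
    have h1 : MDifferentiableAt 𝓘(ℝ, E) 𝓘(ℝ, F) (fun z => (a z)⁻¹) y :=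
      ((contMDiff_inv 𝓘(ℝ, F) ∞).mdifferentiable (by simp) (a y)).comp (I' := 𝓘(ℝ, F)) y had
    have h2 : MDifferentiableAt 𝓘(ℝ, B) 𝓘(ℝ, F) (fun τ => (a (σ τ))⁻¹) (proj K y) :=
      MDifferentiableAt.comp_of_eq (I' := 𝓘(ℝ, E)) (f := σ) (proj K y) h1 hσ hσy
    exact mdifferentiableAt_smul h2 hσ
  have hsy : s (proj K y) = y := by
    simp only [hs, hσy, ha, hA1, inv_one, one_smul]
  have hcont : ContinuousAt (proj K : Q → _) y := (S.mdifferentiable_proj y).continuousAt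
  have hz : (fun z => a z • s (proj K z)) =ᶠ[𝓝 y] id := by
    have h1 : ∀ᶠ z in 𝓝 y, (x, (a (σ (proj K z)))⁻¹ • σ (proj K z)) ∈ momentumLevel E L ν := by
      have hc : ContinuousAt (fun z => σ (proj K z)) y :=
        ContinuousAt.comp (f := proj K) (g := σ) hσ.continuousAt hcont
      have hae' : ∀ᶠ z in 𝓝 (σ (proj K y)), (x, (a z)⁻¹ • z) ∈ momentumLevel E L ν := by
        rwa [hσy]
      exact hc.eventually hae'
    filter_upwards [hae, h1, hcont.eventually hσe] with z h2 h3 h4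
    have e1 := S.good.discreteLift_eq h2
    have e2 := S.good.discreteLift_eq h3
    rw [proj_smul] at e1 e2
    -- both `a z⁻¹ • z` and `s (π z)` are the discrete horizontal lift of `π z` at `x`
    rw [h4, e1] at e2
    show a z • (a (σ (proj K z)))⁻¹ • σ (proj K z) = z
    rw [← e2, smul_inv_smul]
  refine ⟨(mfderiv 𝓘(ℝ, E) 𝓘(ℝ, F) a y : E →L[ℝ] F) v, ?_⟩
  have hcd : MDifferentiableAt 𝓘(ℝ, E) 𝓘(ℝ, E) (fun z => s (proj K z)) y :=
    hsd.comp (I' := 𝓘(ℝ, B)) y (S.mdifferentiable_proj y)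
  have h1 := mfderiv_smul_apply had hcd hA1 hsy v
  have h2 : (mfderiv 𝓘(ℝ, E) 𝓘(ℝ, E) (fun z => s (proj K z)) y : E →L[ℝ] E) v = 0 := by
    have h3 := mfderiv_comp_apply (I := 𝓘(ℝ, E)) (I' := 𝓘(ℝ, B)) (I'' := 𝓘(ℝ, E)) y
      (f := proj K) (g := s) hsd (S.mdifferentiable_proj y) v
    refine h3.trans ?_
    refine (congrArg (mfderiv 𝓘(ℝ, B) 𝓘(ℝ, E) s (proj K y) : B →L[ℝ] E) hv).trans ?_
    exact map_zero _
  have h4 : (mfderiv 𝓘(ℝ, E) 𝓘(ℝ, E) (fun z => a z • s (proj K z)) y : E →L[ℝ] E) v = v := by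
    have h5 := (mdifferentiableAt_id.hasMFDerivAt.congr_of_eventuallyEq (I := 𝓘(ℝ, E)) hz).mfderiv
    refine (congrArg (fun T : E →L[ℝ] E => T v) h5).trans ?_
    exact congrArg (fun T : E →L[ℝ] E => T v) mfderiv_id
  rw [h4, h2] at h1
  exact (h1.trans (add_zero _)).symm

/-- The map whose inverse defines the horizontal lift is an isomorphism. -/
theorem isInvertible_proj_prod_form (S : IsRouthSystem E B L ν) (𝔄 : PrincipalConnection E F K Q)
    (q : Q) {T : E →L[ℝ] B} (hT : T = mfderiv 𝓘(ℝ, E) 𝓘(ℝ, B) (proj K) q) {A : E →L[ℝ] F}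
    (hA : A = 𝔄.form q) : (T.prod A).IsInvertible := by
  have hTi : ∀ ξ : F, T ((infGen E F K q : F →L[ℝ] E) ξ) = 0 := fun ξ => by
    rw [hT]
    exact S.mfderiv_proj_infGen q ξ
  have hAi : ∀ ξ : F, A ((infGen E F K q : F →L[ℝ] E) ξ) = ξ := fun ξ => by
    rw [hA]
    exact 𝔄.form_infGen q ξ
  have hinj : Function.Injective (T.prod A : E →ₗ[ℝ] B × F) := by
    refine (injective_iff_map_eq_zero _).2 fun v hv => ?_
    have h1 : T v = 0 := congrArg Prod.fst hv
    have h2 : A v = 0 := congrArg Prod.snd hv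
    obtain ⟨ξ, hξ⟩ := S.exists_infGen_eq (infGen_injective 𝔄) q (v := v)
      ((congrArg (fun T : E →L[ℝ] B => T v) hT).symm.trans h1)
    have h3 := hAi ξ
    rw [hξ, h2] at h3
    rw [← hξ, ← h3]
    exact map_zero _
  have hsurj : Function.Surjective (T.prod A : E →ₗ[ℝ] B × F) := by
    rintro ⟨w, η⟩
    obtain ⟨v, hv⟩ := S.exists_mfderiv_proj_eq q w
    have hv' : T v = w := (congrArg (fun T : E →L[ℝ] B => T v) hT).trans hv
    obtain ⟨e, he⟩ : ∃ e : E, e = (infGen E F K q : F →L[ℝ] E) (η - A v) := ⟨_, rfl⟩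
    refine ⟨v + e, Prod.ext ?_ ?_⟩
    · show T (v + e) = w
      rw [map_add, hv', he]
      exact (congrArg (w + ·) (hTi _)).trans (add_zero w)
    · show A (v + e) = η
      rw [map_add, he]
      exact (congrArg (A v + ·) (hAi _)).trans (add_sub_cancel _ _)
  refine ⟨(LinearEquiv.ofBijective _ ⟨hinj, hsurj⟩).toContinuousLinearEquiv, ?_⟩
  ext x <;> rfl

/-- The horizontal lift of `w` is the only horizontal vector over `w`. -/
theorem horizontalLift_eq_iff (S : IsRouthSystem E B L ν) (𝔄 : PrincipalConnection E F K Q)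
    (q : Q) {T : E →L[ℝ] B} (hT : T = mfderiv 𝓘(ℝ, E) 𝓘(ℝ, B) (proj K) q) {A : E →L[ℝ] F}
    (hA : A = 𝔄.form q) {H : B →L[ℝ] E} (hH : H = horizontalLift 𝔄 q) (w : B) (v : E) :
    H w = v ↔ T v = w ∧ A v = 0 := by
  have hi := S.isInvertible_proj_prod_form 𝔄 q hT hA
  have h1 : H w = (T.prod A).inverse (w, 0) := by
    rw [hT, hA, hH]
    rfl
  rw [h1, hi.inverse_apply_eq, ContinuousLinearMap.prod_apply, Prod.mk.injEq, eq_comm (a := w),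
    eq_comm (a := (0 : F))]

theorem mfderiv_proj_horizontalLift (S : IsRouthSystem E B L ν) (𝔄 : PrincipalConnection E F K Q)
    (q : Q) {T : E →L[ℝ] B} (hT : T = mfderiv 𝓘(ℝ, E) 𝓘(ℝ, B) (proj K) q)
    {H : B →L[ℝ] E} (hH : H = horizontalLift 𝔄 q) (w : B) : T (H w) = w :=
  ((S.horizontalLift_eq_iff 𝔄 q hT rfl hH w _).1 rfl).1

theorem horizontalLift_smul (S : IsRouthSystem E B L ν) (𝔄 : PrincipalConnection E F K Q)
    (g : K) (q : Q) (w : B) :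
    (horizontalLift 𝔄 (g • q) : B →L[ℝ] E) w =
      (mfderiv 𝓘(ℝ, E) 𝓘(ℝ, E) (fun x : Q => g • x) q : E →L[ℝ] E)
        ((horizontalLift 𝔄 q : B →L[ℝ] E) w) := by
  obtain ⟨h1, h2⟩ := (S.horizontalLift_eq_iff 𝔄 q rfl rfl rfl w _).1 rfl
  refine (S.horizontalLift_eq_iff 𝔄 (g • q) rfl rfl rfl w _).2 ⟨?_, ?_⟩
  · have h := mfderiv_comp_apply (I := 𝓘(ℝ, E)) (I' := 𝓘(ℝ, E)) (I'' := 𝓘(ℝ, B)) q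
      (f := fun x : Q => g • x) (g := proj K) (S.mdifferentiable_proj (g • q))
      (mdifferentiable_smul_right F g q) ((horizontalLift 𝔄 q : B →L[ℝ] E) w)
    refine h.symm.trans ?_
    have e : (proj K ∘ fun x : Q => g • x) = proj K := funext fun x => proj_smul g x
    rw [e]
    exact h1
  · refine (𝔄.form_smul g q _).trans ?_
    exact (congrArg (Ad (E := F) g) h2).trans (map_zero _)

/-- The decomposition of a tangent vector into its horizontal and vertical parts. -/
theorem exists_eq_horizontalLift_add_infGen (S : IsRouthSystem E B L ν)
    (𝔄 : PrincipalConnection E F K Q) (q : Q) {H : B →L[ℝ] E} (hH : H = horizontalLift 𝔄 q)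
    {X : F →L[ℝ] E} (hX : X = infGen E F K q) (v : E) : ∃ (w : B) (ξ : F), v = H w + X ξ := by
  obtain ⟨T, hT⟩ : ∃ T : E →L[ℝ] B, T = mfderiv 𝓘(ℝ, E) 𝓘(ℝ, B) (proj K) q := ⟨_, rfl⟩
  obtain ⟨A, hA⟩ : ∃ A : E →L[ℝ] F, A = 𝔄.form q := ⟨_, rfl⟩
  have h1 : T (X (A v)) = 0 := by
    rw [hT, hX]
    exact S.mfderiv_proj_infGen q _
  have h2 : A (X (A v)) = A v := by
    rw [hX]
    nth_rw 1 [hA]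
    exact 𝔄.form_infGen q _
  have h := (S.horizontalLift_eq_iff 𝔄 q hT hA hH (T v) (v - X (A v))).2
    ⟨by rw [map_sub, h1, sub_zero], by rw [map_sub, h2, sub_self]⟩
  exact ⟨T v, A v, by rw [h, sub_add_cancel]⟩

end IsRouthSystem

end Horizontal

/-! ### The reduced Lagrangian and the reduced force -/

section Reduced

variable {E : Type*} [NormedAddCommGroup E] [NormedSpace ℝ E]
  {F : Type*} [NormedAddCommGroup F] [NormedSpace ℝ F]
  {B : Type*} [NormedAddCommGroup B] [NormedSpace ℝ B]
  {Q : Type*} [TopologicalSpace Q] [ChartedSpace E Q]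
  {K : Type*} [TopologicalSpace K] [ChartedSpace F K] [Group K]
  [MulAction K Q] [ContMDiffSMul 𝓘(ℝ, F) 𝓘(ℝ, E) ∞ K Q]
  [ChartedSpace B (MulAction.orbitRel.Quotient K Q)]
  {L : Q × Q → ℝ} {ν : GroupLieAlgebra 𝓘(ℝ, F) K →L[ℝ] ℝ}

namespace IsRouthSystem

/-- The reduced force at a pair of momentum `ν` is obtained from `D₁L` and the derivative of the
affine discrete connection along horizontal lifts. -/
theorem reducedForceAt_apply [IsManifold 𝓘(ℝ, E) ∞ Q] (S : IsRouthSystem E B L ν)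
    (𝔄 : PrincipalConnection E F K Q) {x y : Q} (h : (x, y) ∈ momentumLevel E L ν) (w z : B)
    {d₀ : E →L[ℝ] ℝ} (hd₀ : d₀ = D₁ E L x y) {H₀ H₁ : B →L[ℝ] E}
    (hH₀ : H₀ = horizontalLift 𝔄 x) (hH₁ : H₁ = horizontalLift 𝔄 y)
    {X : F →L[ℝ] E} (hX : X = infGen E F K x) {A : E × E →L[ℝ] F}
    (hA : A = mfderiv (𝓘(ℝ, E).prod 𝓘(ℝ, E)) 𝓘(ℝ, F) (affineConnection E L ν) (x, y)) :
    (reducedForceAt (B := B) L ν 𝔄 x y : B × B →L[ℝ] ℝ) (w, z) = -d₀ (X (A (H₀ w, H₁ z))) := by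
  obtain ⟨ξ, hξ⟩ : ∃ ξ, ξ = A (H₀ w, H₁ z) := ⟨_, rfl⟩
  have h1 : (reducedForceAt (B := B) L ν 𝔄 x y : B × B →L[ℝ] ℝ) (w, z) =
      (mfderiv 𝓘(ℝ, F) 𝓘(ℝ, ℝ) (fun g : K => checkLagrangian E L ν x g (proj K y)) 1 :
        F →L[ℝ] ℝ) ξ := by
    rw [hξ, hA, hH₀, hH₁]
    rfl
  have h2 : (fun g : K => checkLagrangian E L ν x g (proj K y)) = fun g => L (x, g • y) := by
    ext g
    rw [checkLagrangian, S.good.discreteLift_eq h]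
  have h3 := mfderiv_comp_apply_of_eq (I := 𝓘(ℝ, F)) (I' := 𝓘(ℝ, E)) (I'' := 𝓘(ℝ, ℝ))
    (f := fun g : K => g • y) (g := fun y' => L (x, y')) (x := 1) (y := y)
    ((S.mdifferentiable (x, y)).comp (I' := 𝓘(ℝ, E).prod 𝓘(ℝ, E)) y
      (mdifferentiableAt_const.prodMk mdifferentiableAt_id))
    (mdifferentiable_smul_left (F := F) y 1) (one_smul K y) ξ
  have h4 := D₁_infGen_add_D₂_infGen (K := K) S.mdifferentiable S.good.invariant x y ξ
  rw [h1, h2, ← hξ, hd₀, hX]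
  exact h3.trans (eq_neg_of_add_eq_zero_right h4)

variable [LieGroup 𝓘(ℝ, F) ∞ K]

/-- The representatives chosen in the definition of the reduced objects are a translate of any
given pair of momentum `ν`. -/
theorem exists_out_eq (S : IsRouthSystem E B L ν) {x y : Q} (h : (x, y) ∈ momentumLevel E L ν) :
    ∃ g : K, Quotient.out (proj K x) = g • x ∧
      discreteLift E L ν (Quotient.out (proj K x)) (proj K y) = g • y := by
  obtain ⟨g, hg⟩ := exists_smul_eq_of_proj_eq (K := K) (x := Quotient.out (proj K x)) (y := x)
    (Quotient.out_eq (proj K x))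
  refine ⟨g, hg.symm, ?_⟩
  rw [← hg, ← proj_smul g y]
  exact S.good.discreteLift_eq (S.smul_mem_level g h)

theorem reducedLagrangian_proj (S : IsRouthSystem E B L ν) {x y : Q}
    (h : (x, y) ∈ momentumLevel E L ν) :
    reducedLagrangian E L ν (proj K x, proj K y) = L (x, y) := by
  obtain ⟨g, h1, h2⟩ := S.exists_out_eq h
  simp only [reducedLagrangian, checkLagrangian]
  rw [h2, h1, one_smul, S.good.invariant]

variable [FiniteDimensional ℝ E] [FiniteDimensional ℝ F] [IsManifold 𝓘(ℝ, E) ∞ Q]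

/-- Near the momentum level set, the reduced Lagrangian is computed by moving the first point of a
pair by the affine discrete connection. -/
theorem eventually_reducedLagrangian_proj (S : IsRouthSystem E B L ν)
    (𝔄 : PrincipalConnection E F K Q) {x y : Q} (h : (x, y) ∈ momentumLevel E L ν) :
    ∀ᶠ p in 𝓝 (x, y), reducedLagrangian E L ν (proj K p.1, proj K p.2) =
      L (affineConnection E L ν p • p.1, p.2) := by
  filter_upwards [(S.good.affineConnection_spec S.smooth (infGen_injective 𝔄) h).2.2] with p hp
  have h1 := S.reducedLagrangian_proj hp
  rw [proj_smul] at h1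
  rw [h1, ← S.good.invariant (affineConnection E L ν p) p.1, smul_inv_smul]

theorem mdifferentiableAt_translate (S : IsRouthSystem E B L ν)
    (𝔄 : PrincipalConnection E F K Q) {x y : Q} (h : (x, y) ∈ momentumLevel E L ν) :
    MDifferentiableAt (𝓘(ℝ, E).prod 𝓘(ℝ, E)) 𝓘(ℝ, E)
      (fun p : Q × Q => affineConnection E L ν p • p.1) (x, y) :=
  mdifferentiableAt_smul (S.good.affineConnection_spec S.smooth (infGen_injective 𝔄) h).1
    mdifferentiableAt_fst

theorem affineConnection_smul_fst (S : IsRouthSystem E B L ν)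
    (𝔄 : PrincipalConnection E F K Q) {x y : Q} (h : (x, y) ∈ momentumLevel E L ν) :
    affineConnection E L ν (x, y) • x = x := by
  rw [(S.good.affineConnection_spec S.smooth (infGen_injective 𝔄) h).2.1, one_smul]

/-- The reduced Lagrangian is differentiable at pairs of momentum `ν`: near them, it is the function
`L(𝒜(x, y) • x, y)` evaluated on local sections of the projection. -/
theorem mdifferentiableAt_reducedLagrangian (S : IsRouthSystem E B L ν)
    (𝔄 : PrincipalConnection E F K Q) {x y : Q} (h : (x, y) ∈ momentumLevel E L ν) :
    MDifferentiableAt (𝓘(ℝ, B).prod 𝓘(ℝ, B)) 𝓘(ℝ, ℝ) (reducedLagrangian E L ν)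
      (proj K x, proj K y) := by
  obtain ⟨σ, hσ, hσx, hσe⟩ := exists_local_section (S.submersion.isSubmersionAt x) rfl
  obtain ⟨ρ, hρ, hρy, hρe⟩ := exists_local_section (S.submersion.isSubmersionAt y) rfl
  have hσρ : MDifferentiableAt (𝓘(ℝ, B).prod 𝓘(ℝ, B)) (𝓘(ℝ, E).prod 𝓘(ℝ, E)) (Prod.map σ ρ)
      (proj K x, proj K y) := hσ.prodMap' hρ
  have hL : MDifferentiableAt (𝓘(ℝ, E).prod 𝓘(ℝ, E)) 𝓘(ℝ, ℝ)
      (fun p : Q × Q => L (affineConnection E L ν p • p.1, p.2)) (x, y) :=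
    (S.mdifferentiable _).comp (I' := 𝓘(ℝ, E).prod 𝓘(ℝ, E)) (x, y)
      ((S.mdifferentiableAt_translate 𝔄 h).prodMk mdifferentiableAt_snd)
  have hxy : Prod.map σ ρ (proj K x, proj K y) = (x, y) := Prod.ext hσx hρy
  refine (MDifferentiableAt.comp_of_eq (I' := 𝓘(ℝ, E).prod 𝓘(ℝ, E)) (f := Prod.map σ ρ)
    (proj K x, proj K y) hL hσρ hxy).congr_of_eventuallyEq ?_
  have h1 : ∀ᶠ τ in 𝓝 (proj K x, proj K y),
      reducedLagrangian E L ν (proj K (σ τ.1), proj K (ρ τ.2)) =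
        L (affineConnection E L ν (Prod.map σ ρ τ) • σ τ.1, ρ τ.2) := by
    have h2 := S.eventually_reducedLagrangian_proj 𝔄 h
    rw [← hxy] at h2
    exact hσρ.continuousAt.eventually h2
  filter_upwards [h1, (continuousAt_fst (p := (proj K x, proj K y))).eventually hσe,
    (continuousAt_snd (p := (proj K x, proj K y))).eventually hρe] with τ h2 h3 h4
  rw [h3, h4] at h2
  exact h2

/-- The differential of the reduced Lagrangian: it differs from that of `L` by the derivative of
the affine discrete connection, acting through infinitesimal generators. -/
theorem mfderiv_reducedLagrangian (S : IsRouthSystem E B L ν)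
    (𝔄 : PrincipalConnection E F K Q) {x y : Q} (h : (x, y) ∈ momentumLevel E L ν) (u v : E)
    {T₀ T₁ : E →L[ℝ] B} (hT₀ : T₀ = mfderiv 𝓘(ℝ, E) 𝓘(ℝ, B) (proj K) x)
    (hT₁ : T₁ = mfderiv 𝓘(ℝ, E) 𝓘(ℝ, B) (proj K) y)
    {l₀ l₁ : B →L[ℝ] ℝ} (hl₀ : l₀ = D₁ B (reducedLagrangian E L ν) (proj K x) (proj K y))
    (hl₁ : l₁ = D₂ B (reducedLagrangian E L ν) (proj K x) (proj K y))
    {d₀ d₁ : E →L[ℝ] ℝ} (hd₀ : d₀ = D₁ E L x y) (hd₁ : d₁ = D₂ E L x y)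
    {X : F →L[ℝ] E} (hX : X = infGen E F K x) {A : E × E →L[ℝ] F}
    (hA : A = mfderiv (𝓘(ℝ, E).prod 𝓘(ℝ, E)) 𝓘(ℝ, F) (affineConnection E L ν) (x, y)) :
    l₀ (T₀ u) + l₁ (T₁ v) = d₀ (X (A (u, v)) + u) + d₁ v := by
  have h1 := mfderiv_comp₂_apply (P := Q × Q) (I₄ := 𝓘(ℝ, E).prod 𝓘(ℝ, E)) (p := (x, y))
    (a := fun p => proj K p.1) (b := fun p => proj K p.2)
    (S.mdifferentiableAt_reducedLagrangian 𝔄 h)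
    ((S.mdifferentiable_proj x).comp (I' := 𝓘(ℝ, E)) (x, y) mdifferentiableAt_fst)
    ((S.mdifferentiable_proj y).comp (I' := 𝓘(ℝ, E)) (x, y) mdifferentiableAt_snd) rfl rfl (u, v)
  have h2 := mfderiv_comp₂_apply (P := Q × Q) (I₄ := 𝓘(ℝ, E).prod 𝓘(ℝ, E)) (p := (x, y))
    (b := Prod.snd) (S.mdifferentiable (x, y)) (S.mdifferentiableAt_translate 𝔄 h)
    mdifferentiableAt_snd (S.affineConnection_smul_fst 𝔄 h) rfl (u, v)
  obtain ⟨hAd, hA1, -⟩ := S.good.affineConnection_spec S.smooth (infGen_injective 𝔄) h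
  have h3 := mfderiv_smul_apply (c := Prod.fst) hAd mdifferentiableAt_fst hA1 rfl (u, v)
  have e1 : (mfderiv (𝓘(ℝ, E).prod 𝓘(ℝ, E)) 𝓘(ℝ, B) (fun p : Q × Q => proj K p.1) (x, y) :
      E × E →L[ℝ] B) (u, v) = T₀ u := by
    rw [hT₀]
    refine (mfderiv_comp_apply (I := 𝓘(ℝ, E).prod 𝓘(ℝ, E)) (I' := 𝓘(ℝ, E)) (I'' := 𝓘(ℝ, B)) (x, y)
      (f := Prod.fst) (g := proj K) (S.mdifferentiable_proj x)
        mdifferentiableAt_fst (u, v)).trans ?_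
    rw [mfderiv_fst]
    rfl
  have e2 : (mfderiv (𝓘(ℝ, E).prod 𝓘(ℝ, E)) 𝓘(ℝ, B) (fun p : Q × Q => proj K p.2) (x, y) :
      E × E →L[ℝ] B) (u, v) = T₁ v := by
    rw [hT₁]
    refine (mfderiv_comp_apply (I := 𝓘(ℝ, E).prod 𝓘(ℝ, E)) (I' := 𝓘(ℝ, E)) (I'' := 𝓘(ℝ, B)) (x, y)
      (f := Prod.snd) (g := proj K) (S.mdifferentiable_proj y)
        mdifferentiableAt_snd (u, v)).trans ?_
    rw [mfderiv_snd]
    rfl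
  have e3 : (mfderiv (𝓘(ℝ, E).prod 𝓘(ℝ, E)) 𝓘(ℝ, E)
      (fun p : Q × Q => affineConnection E L ν p • p.1) (x, y) : E × E →L[ℝ] E) (u, v) =
        X (A (u, v)) + u := by
    rw [hX, hA]
    refine h3.trans ?_
    rw [mfderiv_fst]
    rfl
  have e4 : (mfderiv (𝓘(ℝ, E).prod 𝓘(ℝ, E)) 𝓘(ℝ, E) (Prod.snd : Q × Q → Q) (x, y) :
      E × E →L[ℝ] E) (u, v) = v := by
    rw [mfderiv_snd]
    rfl
  have e5 : (mfderiv (𝓘(ℝ, E).prod 𝓘(ℝ, E)) 𝓘(ℝ, ℝ)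
      (fun p : Q × Q => reducedLagrangian E L ν (proj K p.1, proj K p.2)) (x, y) :
        E × E →L[ℝ] ℝ) (u, v) =
      (mfderiv (𝓘(ℝ, E).prod 𝓘(ℝ, E)) 𝓘(ℝ, ℝ)
        (fun p : Q × Q => L (affineConnection E L ν p • p.1, p.2)) (x, y) :
        E × E →L[ℝ] ℝ) (u, v) :=
    congrArg (fun T : E × E →L[ℝ] ℝ => T (u, v))
      (EventuallyEq.mfderiv_eq (I := 𝓘(ℝ, E).prod 𝓘(ℝ, E)) (I' := 𝓘(ℝ, ℝ))
        (S.eventually_reducedLagrangian_proj 𝔄 h))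
  rw [e1, e2] at h1
  rw [e3, e4] at h2
  rw [hl₀, hl₁, hd₀, hd₁]
  exact h1.symm.trans (e5.trans h2)

/-- The horizontal part of the differential of `L` at a pair of momentum `ν` is the differential of
the reduced Lagrangian corrected by the reduced force. -/
theorem dReduced_add_reducedForceAt (S : IsRouthSystem E B L ν)
    (𝔄 : PrincipalConnection E F K Q) {x y : Q} (h : (x, y) ∈ momentumLevel E L ν) (w z : B)
    {l₀ l₁ : B →L[ℝ] ℝ} (hl₀ : l₀ = D₁ B (reducedLagrangian E L ν) (proj K x) (proj K y))
    (hl₁ : l₁ = D₂ B (reducedLagrangian E L ν) (proj K x) (proj K y))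
    {d₀ d₁ : E →L[ℝ] ℝ} (hd₀ : d₀ = D₁ E L x y) (hd₁ : d₁ = D₂ E L x y)
    {H₀ H₁ : B →L[ℝ] E} (hH₀ : H₀ = horizontalLift 𝔄 x) (hH₁ : H₁ = horizontalLift 𝔄 y)
    {f : B × B →L[ℝ] ℝ} (hf : f = reducedForceAt (B := B) L ν 𝔄 x y) :
    l₀ w + l₁ z + f (w, z) = d₀ (H₀ w) + d₁ (H₁ z) := by
  obtain ⟨T₀, hT₀⟩ : ∃ T : E →L[ℝ] B, T = mfderiv 𝓘(ℝ, E) 𝓘(ℝ, B) (proj K) x := ⟨_, rfl⟩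
  obtain ⟨T₁, hT₁⟩ : ∃ T : E →L[ℝ] B, T = mfderiv 𝓘(ℝ, E) 𝓘(ℝ, B) (proj K) y := ⟨_, rfl⟩
  obtain ⟨X, hX⟩ : ∃ X : F →L[ℝ] E, X = infGen E F K x := ⟨_, rfl⟩
  obtain ⟨A, hA⟩ : ∃ A : E × E →L[ℝ] F,
    A = mfderiv (𝓘(ℝ, E).prod 𝓘(ℝ, E)) 𝓘(ℝ, F) (affineConnection E L ν) (x, y) := ⟨_, rfl⟩
  have h1 := S.mfderiv_reducedLagrangian 𝔄 h (H₀ w) (H₁ z) hT₀ hT₁ hl₀ hl₁ hd₀ hd₁ hX hA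
  have h2 : f (w, z) = -d₀ (X (A (H₀ w, H₁ z))) := by
    rw [hf]
    exact S.reducedForceAt_apply 𝔄 h w z hd₀ hH₀ hH₁ hX hA
  rw [S.mfderiv_proj_horizontalLift 𝔄 x hT₀ hH₀, S.mfderiv_proj_horizontalLift 𝔄 y hT₁ hH₁,
    map_add] at h1
  rw [h1, h2]
  ring

/-- The identity of `dReduced_add_reducedForceAt` for the reduced force itself, whose definition
uses a representative `(g • x, g • y)` of the pair: the right-hand side does not depend on `g`. -/
theorem dReduced_add_reducedForce (S : IsRouthSystem E B L ν)
    (𝔄 : PrincipalConnection E F K Q) {x y : Q} (h : (x, y) ∈ momentumLevel E L ν) (w z : B)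
    {l₀ l₁ : B →L[ℝ] ℝ} (hl₀ : l₀ = D₁ B (reducedLagrangian E L ν) (proj K x) (proj K y))
    (hl₁ : l₁ = D₂ B (reducedLagrangian E L ν) (proj K x) (proj K y))
    {d₀ d₁ : E →L[ℝ] ℝ} (hd₀ : d₀ = D₁ E L x y) (hd₁ : d₁ = D₂ E L x y)
    {H₀ H₁ : B →L[ℝ] E} (hH₀ : H₀ = horizontalLift 𝔄 x) (hH₁ : H₁ = horizontalLift 𝔄 y)
    {f : B × B →L[ℝ] ℝ} (hf : f = reducedForce (B := B) L ν 𝔄 (proj K x) (proj K y)) :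
    l₀ w + l₁ z + f (w, z) = d₀ (H₀ w) + d₁ (H₁ z) := by
  obtain ⟨g, h1, h2⟩ := S.exists_out_eq h
  have hf' : f = reducedForceAt (B := B) L ν 𝔄 (g • x) (g • y) := by
    rw [hf, reducedForce, h2, h1]
  have hl₀' : l₀ = D₁ B (reducedLagrangian E L ν) (proj K (g • x)) (proj K (g • y)) := by
    rw [hl₀, proj_smul, proj_smul]
  have hl₁' : l₁ = D₂ B (reducedLagrangian E L ν) (proj K (g • x)) (proj K (g • y)) := by
    rw [hl₁, proj_smul, proj_smul]
  have h3 := S.dReduced_add_reducedForceAt 𝔄 (S.smul_mem_level g h) w z hl₀' hl₁'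
    rfl rfl rfl rfl hf'
  rw [h3, hd₀, hd₁, hH₀, hH₁]
  exact congrArg₂ (· + ·)
    ((congrArg (D₁ E L (g • x) (g • y)) (S.horizontalLift_smul 𝔄 g x w)).trans
      (D₁_smul F S.mdifferentiable S.good.invariant g x y _))
    ((congrArg (D₂ E L (g • x) (g • y)) (S.horizontalLift_smul 𝔄 g y z)).trans
      (D₂_smul F S.mdifferentiable S.good.invariant g x y _))

theorem dReduced_add_reducedForce_fst (S : IsRouthSystem E B L ν)
    (𝔄 : PrincipalConnection E F K Q) {x y : Q} (h : (x, y) ∈ momentumLevel E L ν) (w : B) :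
    (D₁ B (reducedLagrangian E L ν) (proj K x) (proj K y) : B →L[ℝ] ℝ) w +
        ((reducedForce (B := B) L ν 𝔄).minus (proj K x) (proj K y) : B →L[ℝ] ℝ) w =
      (D₁ E L x y : E →L[ℝ] ℝ) ((horizontalLift 𝔄 x : B →L[ℝ] E) w) := by
  obtain ⟨l, hl⟩ : ∃ l : B →L[ℝ] ℝ,
    l = D₂ B (reducedLagrangian E L ν) (proj K x) (proj K y) := ⟨_, rfl⟩
  obtain ⟨d, hd⟩ : ∃ d : E →L[ℝ] ℝ, d = D₂ E L x y := ⟨_, rfl⟩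
  obtain ⟨H, hH⟩ : ∃ H : B →L[ℝ] E, H = horizontalLift 𝔄 y := ⟨_, rfl⟩
  have h1 := S.dReduced_add_reducedForce 𝔄 h w 0 rfl hl rfl hd rfl hH rfl
  rw [map_zero, map_zero, map_zero, add_zero, add_zero] at h1
  exact h1

theorem dReduced_add_reducedForce_snd (S : IsRouthSystem E B L ν)
    (𝔄 : PrincipalConnection E F K Q) {x y : Q} (h : (x, y) ∈ momentumLevel E L ν) (w : B) :
    (D₂ B (reducedLagrangian E L ν) (proj K x) (proj K y) : B →L[ℝ] ℝ) w +
        ((reducedForce (B := B) L ν 𝔄).plus (proj K x) (proj K y) : B →L[ℝ] ℝ) w =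
      (D₂ E L x y : E →L[ℝ] ℝ) ((horizontalLift 𝔄 y : B →L[ℝ] E) w) := by
  obtain ⟨l, hl⟩ : ∃ l : B →L[ℝ] ℝ,
    l = D₁ B (reducedLagrangian E L ν) (proj K x) (proj K y) := ⟨_, rfl⟩
  obtain ⟨d, hd⟩ : ∃ d : E →L[ℝ] ℝ, d = D₁ E L x y := ⟨_, rfl⟩
  obtain ⟨H, hH⟩ : ∃ H : B →L[ℝ] E, H = horizontalLift 𝔄 x := ⟨_, rfl⟩
  have h1 := S.dReduced_add_reducedForce 𝔄 h 0 w hl rfl hd rfl hH rfl rfl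
  rw [map_zero, map_zero, map_zero, zero_add, zero_add] at h1
  exact h1

/-- At an interior point of a curve of momentum `ν`, the discrete Euler–Lagrange equation is
equivalent to its reduced counterpart: the former vanishes on vertical vectors by conservation of
momentum, and on horizontal vectors it is the latter. -/
theorem eulerLagrange_iff_reduced (S : IsRouthSystem E B L ν)
    (𝔄 : PrincipalConnection E F K Q) {x y z : Q} (hxy : (x, y) ∈ momentumLevel E L ν)
    (hyz : (y, z) ∈ momentumLevel E L ν) :
    D₂ E L x y + D₁ E L y z = 0 ↔
      D₁ B (reducedLagrangian E L ν) (proj K y) (proj K z)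
        + D₂ B (reducedLagrangian E L ν) (proj K x) (proj K y)
        + (reducedForce (B := B) L ν 𝔄).plus (proj K x) (proj K y)
        + (reducedForce (B := B) L ν 𝔄).minus (proj K y) (proj K z) = 0 := by
  obtain ⟨d₂, hd₂⟩ : ∃ d : E →L[ℝ] ℝ, d = D₂ E L x y := ⟨_, rfl⟩
  obtain ⟨d₁, hd₁⟩ : ∃ d : E →L[ℝ] ℝ, d = D₁ E L y z := ⟨_, rfl⟩
  obtain ⟨l₁, hl₁⟩ : ∃ l : B →L[ℝ] ℝ,
    l = D₁ B (reducedLagrangian E L ν) (proj K y) (proj K z) := ⟨_, rfl⟩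
  obtain ⟨l₂, hl₂⟩ : ∃ l : B →L[ℝ] ℝ,
    l = D₂ B (reducedLagrangian E L ν) (proj K x) (proj K y) := ⟨_, rfl⟩
  obtain ⟨f₂, hf₂⟩ : ∃ f : B →L[ℝ] ℝ,
    f = (reducedForce (B := B) L ν 𝔄).plus (proj K x) (proj K y) := ⟨_, rfl⟩
  obtain ⟨f₁, hf₁⟩ : ∃ f : B →L[ℝ] ℝ,
    f = (reducedForce (B := B) L ν 𝔄).minus (proj K y) (proj K z) := ⟨_, rfl⟩
  obtain ⟨H, hH⟩ : ∃ H : B →L[ℝ] E, H = horizontalLift 𝔄 y := ⟨_, rfl⟩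
  obtain ⟨X, hX⟩ : ∃ X : F →L[ℝ] E, X = infGen E F K y := ⟨_, rfl⟩
  -- horizontal vectors
  have hhor : ∀ w : B, (l₁ + l₂ + f₂ + f₁) w = (d₂ + d₁) (H w) := by
    intro w
    have h1 : l₂ w + f₂ w = d₂ (H w) := by
      have := S.dReduced_add_reducedForce_snd 𝔄 hxy w
      rw [hl₂, hf₂, hd₂, hH]
      exact this
    have h2 : l₁ w + f₁ w = d₁ (H w) := by
      have := S.dReduced_add_reducedForce_fst 𝔄 hyz w
      rw [hl₁, hf₁, hd₁, hH]
      exact this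
    simp only [add_apply]
    linarith
  -- vertical vectors: conservation of momentum
  have hver : ∀ ξ : F, (d₂ + d₁) (X ξ) = 0 := by
    intro ξ
    obtain ⟨c, hc⟩ : ∃ c : ℝ, c = (D₁ E L x y : E →L[ℝ] ℝ) ((infGen E F K x : F →L[ℝ] E) ξ) :=
      ⟨_, rfl⟩
    have h1 : c + d₂ (X ξ) = 0 := by
      rw [hc, hd₂, hX]
      exact D₁_infGen_add_D₂_infGen (K := K) S.mdifferentiable S.good.invariant x y ξ
    have h2 : -c = ν ξ := by
      rw [hc]
      exact congrArg (fun T : F →L[ℝ] ℝ => T ξ) hxy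
    have h3 : -d₁ (X ξ) = ν ξ := by
      rw [hd₁, hX]
      exact congrArg (fun T : F →L[ℝ] ℝ => T ξ) hyz
    rw [add_apply]
    linarith
  have hiff : d₂ + d₁ = 0 ↔ l₁ + l₂ + f₂ + f₁ = 0 := by
    constructor
    · intro h
      ext w
      rw [hhor, h]
      rfl
    · intro h
      ext v
      obtain ⟨w, ξ, rfl⟩ := S.exists_eq_horizontalLift_add_infGen 𝔄 y hH hX v
      rw [map_add, hver, ← hhor, h]
      simp
  rw [hd₂, hd₁, hl₁, hl₂, hf₁, hf₂] at hiff
  exact hiff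

end IsRouthSystem

end Reduced

/-! ### The coadjoint isotropy group -/

section Isotropy

variable {E : Type*} [NormedAddCommGroup E] [NormedSpace ℝ E]
  {G : Type*} [TopologicalSpace G] [ChartedSpace E G] [Group G] [LieGroup 𝓘(ℝ, E) ∞ G]
  (μ : GroupLieAlgebra 𝓘(ℝ, E) G →L[ℝ] ℝ)
  {F : Type*} [NormedAddCommGroup F] [NormedSpace ℝ F] [ChartedSpace F (coadjointIsotropy μ)]

/-- The action of the isotropy group is smooth, as a restriction of the action of `G`. -/
theorem contMDiffSMul_coadjointIsotropy
    (hμ : ContMDiff 𝓘(ℝ, F) 𝓘(ℝ, E) ∞ (Subtype.val : coadjointIsotropy μ → G))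
    {E' : Type*} [NormedAddCommGroup E'] [NormedSpace ℝ E']
    {Q : Type*} [TopologicalSpace Q] [ChartedSpace E' Q] [MulAction G Q]
    [ContMDiffSMul 𝓘(ℝ, E) 𝓘(ℝ, E') ∞ G Q] :
    ContMDiffSMul 𝓘(ℝ, F) 𝓘(ℝ, E') ∞ (coadjointIsotropy μ) Q :=
  ⟨(contMDiff_smul (I := 𝓘(ℝ, E)) (I' := 𝓘(ℝ, E')) (n := ∞) (G := G) (M := Q)).comp
    ((hμ.comp contMDiff_fst).prodMk contMDiff_snd)⟩

/-- The restriction of `μ` to the Lie algebra of its isotropy group is invariant under the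
coadjoint action of that group. -/
theorem restrictToIsotropy_comp_Ad [LieGroup 𝓘(ℝ, F) ∞ (coadjointIsotropy μ)]
    (hμ : ContMDiff 𝓘(ℝ, F) 𝓘(ℝ, E) ∞ (Subtype.val : coadjointIsotropy μ → G))
    (g : coadjointIsotropy μ) :
    (restrictToIsotropy F μ).comp (Ad g) = restrictToIsotropy F μ := by
  obtain ⟨i, hi⟩ : ∃ i : F →L[ℝ] E,
    i = mfderiv 𝓘(ℝ, F) 𝓘(ℝ, E) (Subtype.val : coadjointIsotropy μ → G) 1 := ⟨_, rfl⟩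
  have hμd := hμ.mdifferentiable (by simp)
  have hAd : ∀ ξ : F, i ((Ad (E := F) g : F →L[ℝ] F) ξ) =
      (Ad (E := E) (g : G) : E →L[ℝ] E) (i ξ) := by
    intro ξ
    have h1 := mfderiv_comp_apply_of_eq (I := 𝓘(ℝ, F)) (I' := 𝓘(ℝ, F)) (I'' := 𝓘(ℝ, E))
      (f := fun h : coadjointIsotropy μ => g * h * g⁻¹)
      (g := (Subtype.val : coadjointIsotropy μ → G)) (x := 1) (y := 1)
      (hμd 1) (mdifferentiableAt_conj g 1) (by simp) ξ
    have h2 := mfderiv_comp_apply_of_eq (I := 𝓘(ℝ, F)) (I' := 𝓘(ℝ, E)) (I'' := 𝓘(ℝ, E))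
      (f := (Subtype.val : coadjointIsotropy μ → G))
      (g := fun h : G => (g : G) * h * (g : G)⁻¹) (x := 1) (y := 1)
      (mdifferentiableAt_conj (g : G) 1) (hμd 1) rfl ξ
    rw [hi]
    exact h1.symm.trans h2
  have hg : μ.comp (Ad (g : G)) = μ := by
    have := (coadjointIsotropy μ).inv_mem g.2
    have h1 : μ.comp (Ad (g : G)⁻¹⁻¹) = μ := this
    rwa [inv_inv] at h1
  ext ξ
  have h1 : (restrictToIsotropy F μ) (Ad g ξ) =
      (μ : E →L[ℝ] ℝ) (i ((Ad (E := F) g : F →L[ℝ] F) ξ)) := by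
    rw [hi]
    rfl
  refine h1.trans ((congrArg (μ : E →L[ℝ] ℝ) (hAd ξ)).trans ?_)
  rw [hi]
  exact congrArg (fun T : E →L[ℝ] ℝ => T _) hg

end Isotropy

end DiscreteRouth

theorem mainTheorem5
    -- the configuration manifold `Q`
    {EQ : Type*} [NormedAddCommGroup EQ] [NormedSpace ℝ EQ] [FiniteDimensional ℝ EQ]
    {Q : Type*} [TopologicalSpace Q] [T2Space Q] [SecondCountableTopology Q]
    [ChartedSpace EQ Q] [IsManifold 𝓘(ℝ, EQ) ∞ Q]
    -- the Lie group `G`, acting smoothly, freely and properly on `Q`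
    {EG : Type*} [NormedAddCommGroup EG] [NormedSpace ℝ EG] [FiniteDimensional ℝ EG]
    {G : Type*} [TopologicalSpace G] [T2Space G] [SecondCountableTopology G]
    [ChartedSpace EG G] [Group G] [LieGroup 𝓘(ℝ, EG) ∞ G]
    [MulAction G Q] [ContMDiffSMul 𝓘(ℝ, EG) 𝓘(ℝ, EQ) ∞ G Q] [IsCancelSMul G Q] [ProperSMul G Q]
    (μ : GroupLieAlgebra 𝓘(ℝ, EG) G →L[ℝ] ℝ)
    -- the structure of an embedded Lie subgroup on `G_μ`
    {Eμ : Type*} [NormedAddCommGroup Eμ] [NormedSpace ℝ Eμ] [FiniteDimensional ℝ Eμ]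
    [ChartedSpace Eμ (DiscreteRouth.coadjointIsotropy μ)]
    [LieGroup 𝓘(ℝ, Eμ) ∞ (DiscreteRouth.coadjointIsotropy μ)]
    (hGμ : Manifold.IsSmoothEmbedding 𝓘(ℝ, Eμ) 𝓘(ℝ, EG) ∞
      (Subtype.val : DiscreteRouth.coadjointIsotropy μ → G))
    -- the structure of a quotient manifold on `Q/G_μ`
    {EB : Type*} [NormedAddCommGroup EB] [NormedSpace ℝ EB] [FiniteDimensional ℝ EB]
    [ChartedSpace EB (MulAction.orbitRel.Quotient (DiscreteRouth.coadjointIsotropy μ) Q)]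
    [IsManifold 𝓘(ℝ, EB) ∞ (MulAction.orbitRel.Quotient (DiscreteRouth.coadjointIsotropy μ) Q)]
    (hπ : Manifold.IsSubmersion 𝓘(ℝ, EQ) 𝓘(ℝ, EB) ∞
      (DiscreteRouth.proj (DiscreteRouth.coadjointIsotropy μ) : Q → _))
    -- the discrete Lagrangian, for which `G_μ` is a group of `μ`-good symmetries
    (L : Q × Q → ℝ) (hL : ContMDiff (𝓘(ℝ, EQ).prod 𝓘(ℝ, EQ)) 𝓘(ℝ, ℝ) ∞ L)
    (hgood : DiscreteRouth.IsGoodSymmetry EQ L (DiscreteRouth.restrictToIsotropy Eμ μ))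
    -- a principal connection on `Q → Q/G_μ`
    (𝔄 : DiscreteRouth.PrincipalConnection EQ Eμ (DiscreteRouth.coadjointIsotropy μ) Q)
    -- a discrete curve with momentum `μ`, and its projection to `Q/G_μ`
    (N : ℕ) (q : Fin (N + 1) → Q)
    (hq : ∀ k : Fin N, (q k.castSucc, q k.succ) ∈
      DiscreteRouth.momentumLevel EQ L (DiscreteRouth.restrictToIsotropy Eμ μ))
    (τ : Fin (N + 1) → MulAction.orbitRel.Quotient (DiscreteRouth.coadjointIsotropy μ) Q)
    (hτ : ∀ k, τ k = DiscreteRouth.proj (DiscreteRouth.coadjointIsotropy μ) (q k)) :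
    List.TFAE [
      DiscreteRouth.IsTrajectory EQ L q,
      DiscreteRouth.DiscreteEulerLagrange EQ L q,
      DiscreteRouth.IsForcedTrajectory
        (DiscreteRouth.reducedLagrangian EQ L (DiscreteRouth.restrictToIsotropy Eμ μ))
        (DiscreteRouth.reducedForce (B := EB) L (DiscreteRouth.restrictToIsotropy Eμ μ) 𝔄) τ,
      DiscreteRouth.ForcedDiscreteEulerLagrange
        (DiscreteRouth.reducedLagrangian EQ L (DiscreteRouth.restrictToIsotropy Eμ μ))
        (DiscreteRouth.reducedForce (B := EB) L (DiscreteRouth.restrictToIsotropy Eμ μ) 𝔄) τ] := by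
  have hμ := hGμ.contMDiff
  have := DiscreteRouth.contMDiffSMul_coadjointIsotropy (E' := EQ) (Q := Q) μ hμ
  have S : DiscreteRouth.IsRouthSystem EQ EB L (DiscreteRouth.restrictToIsotropy Eμ μ) :=
    ⟨hL, hgood, DiscreteRouth.restrictToIsotropy_comp_Ad μ hμ, hπ⟩
  obtain rfl : τ = fun k => DiscreteRouth.proj (DiscreteRouth.coadjointIsotropy μ) (q k) :=
    funext hτ
  tfae_have 1 ↔ 2 := DiscreteRouth.isTrajectory_iff fun k => S.mdifferentiable _
  tfae_have 3 ↔ 4 := DiscreteRouth.isForcedTrajectory_iff fun k =>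
    S.mdifferentiableAt_reducedLagrangian 𝔄 (hq k)
  tfae_have 2 ↔ 4 := by
    refine forall₄_congr fun k h₂ h₁ h₀ => ?_
    exact S.eulerLagrange_iff_reduced 𝔄 (hq ⟨k, by omega⟩) (hq ⟨k + 1, by omega⟩)
  tfae_finish
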